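/- Conventions. All algebras and modules are complex; $\mathbb N=\{0,1,2,\dots\}$. Inner products of Hilbert modules are linear in the second variable. For subsets $X,Y$ of a C*-algebra $B$ (in particular for subspaces), $X\cdot Y$ denotes the closed linear span of the products $xy$ with $x\in X$, $y\in Y$, and $X^*=\{x^*: x\in X\}$. Let $A$ be a C*-algebra. An $A,A$-correspondence is a right Hilbert $A$-module with a (possibly degenerate) left action of $A$ given by a $*$-homomorphism to the adjointable operators. A weak partial product system consists of $A$, of $A,A$-correspondences $\mathcal E_n$ for $n\in\mathbb N$ with $\mathcal E_0=A$, and of isometric bimodule maps $\mu_{n,m}\colon\mathcal E_n\otimes_A\mathcal E_m\to\mathcal E_{n+m}$, written $x\cdot y=\mu_{n,m}(x\otimes y)$, that are associative and such that $\mu_{0,m}$ and $\mu_{m,0}$ are given by the bimodule structure. Its Fock module is the Hilbert module direct sum $\mathcal F=\bigoplus_{n\in\mathbb N}\mathcal E_n$. For $x\in\mathcal E_n$ the creation operator $S_n(x)\colon\mathcal F\to\mathcal F$ is given by $y\mapsto x\cdot y$ for $y\in\mathcal E_m$. The weak Fock representation exists if $S_n(x)$ is adjointable for all $n\in\mathbb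 N$ and $x\in\mathcal E_n$; then $S_n(x)^*y\in\mathcal E_{m-n}$ for $y\in\mathcal E_m$, $m\ge n$. A weak representation in a C*-algebra $B$ consists of linear maps $\omega_n\colon\mathcal E_n\to B$, $n\in\mathbb N$, with $\omega_n(x)\omega_m(y)=\omega_{n+m}(x\cdot y)$ for $x\in\mathcal E_n$, $y\in\mathcal E_m$, and $\omega_n(x)^*\omega_n(y)=\omega_0(\langle x,y\rangle)$ for $x,y\in\mathcal E_n$. It is a representation if, in addition, $\omega_n(\mathcal E_n)^*\cdot\omega_m(\mathcal E_m)\subseteq\omega_{m-n}(\mathcal E_{m-n})\cdot B$ for all $m>n>0$ and $\omega_n(\mathcal E_n)^*\cdot\omega_m(\mathcal E_m)\subseteq\omega_{n-m}(\mathcal E_{n-m})^*\cdot B$ for all $0<m<n$. Let $\mathbb K(\mathcal E_m,\mathcal E_n)$ be the closed linear span of the operators $|x\rangle\langle y|\colon z\mapsto x\langle y,z\rangle$ with $x\in\mathcal E_n$, $y\in\mathcal E_m$. Proposition. Let $(A,\mathcal E_n,\mu_{n,m})$ be a weak partial product system for which the weak Fock representation exists, and let $(\omega_n)$ be a weak representation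 of it in a C*-algebra $B$. There is a unique family of bounded linear maps $\Theta_{m,n}\colon\mathbb K(\mathcal E_m,\mathcal E_n)\to B$ with $\Theta_{m,n}(|x\rangle\langle y|)=\omega_n(x)\omega_m(y)^*$ for all $m,n\in\mathbb N$, $x\in\mathcal E_n$, $y\in\mathcal E_m$, and the following are equivalent: 1. $\omega_n(x)^*\omega_m(y)=\omega_{m-n}(S_n(x)^*y)$ for all $n,m\ge1$ with $m>n$ and all $x\in\mathcal E_n$, $y\in\mathcal E_m$; 2. $\omega_n(x)^*\omega_m(y)=\omega_{n-m}(S_m(y)^*x)^*$ for all $n,m\ge1$ with $n>m$ and all $x\in\mathcal E_n$, $y\in\mathcal E_m$; 3. $\omega_n(\mathcal E_n)^*\cdot\omega_m(\mathcal E_m)\subseteq\omega_{m-n}(\mathcal E_{m-n})$ for all $n,m\ge1$ with $m>n$; 4. $\omega_n(\mathcal E_n)^*\cdot\omega_m(\mathcal E_m)\subseteq\omega_{n-m}(\mathcal E_{n-m})^*$ for all $n,m\ge1$ with $m<n$; 5. $\omega_n(\mathcal E_n)^*\cdot\omega_m(\mathcal E_m)\cdot B\subseteq\omega_{m-n}(\mathcal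 E_{m-n})\cdot B$ for all $n,m\in\mathbb N$ with $m>n$; 6. $B\cdot\omega_n(\mathcal E_n)^*\cdot\omega_m(\mathcal E_m)\subseteq B\cdot\omega_{n-m}(\mathcal E_{n-m})^*$ for all $n,m\ge1$ with $m<n$; 7. for all $m,n,p,q\in\mathbb N$, the subspace $\Theta_{m,n}(\mathbb K(\mathcal E_m,\mathcal E_n))\cdot\Theta_{p,q}(\mathbb K(\mathcal E_p,\mathcal E_q))$ is contained in $\Theta_{m-q+p,n}(\mathbb K(\mathcal E_{m-q+p},\mathcal E_n))$ if $m\ge q$, and in $\Theta_{p,n+q-m}(\mathbb K(\mathcal E_p,\mathcal E_{n+q-m}))$ if $m\le q$. These conditions hold if and only if $(\omega_n)$ is a representation. Moreover, they imply $\omega_n(\mathcal E_n)^*\cdot\omega_m(\mathcal E_m)\cdot B\subseteq\omega_{n-m}(\mathcal E_{n-m})^*\cdot B$ for all $n,m\ge1$ with $m<n$. -/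

import Mathlib

namespace PPS

/-! ### Hilbert modules and correspondences -/

/-- A (right) Hilbert module over a C*-algebra `A`, with `A`-valued inner product linear in the
second variable and `⟪x, y a⟫ = ⟪x, y⟫ a`. (Mathlib's `CStarModule` uses the law
`⟪x, a y⟫ = a ⟪x, y⟫` of a left action, so it is not used.) Completeness is imposed by a separate
instance `CompleteSpace E`. -/
class HilbertModule (A E : Type*) [NonUnitalCStarAlgebra A] [PartialOrder A] [StarOrderedRing A]
    [NormedAddCommGroup E] [NormedSpace ℂ E] extends Inner A E where
  /-- The right action `x a`. -/
  rsmul : E → A → E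
  add_rsmul : ∀ (x y : E) (a : A), rsmul (x + y) a = rsmul x a + rsmul y a
  rsmul_add : ∀ (x : E) (a b : A), rsmul x (a + b) = rsmul x a + rsmul x b
  smul_rsmul : ∀ (c : ℂ) (x : E) (a : A), rsmul (c • x) a = c • rsmul x a
  rsmul_smul : ∀ (c : ℂ) (x : E) (a : A), rsmul x (c • a) = c • rsmul x a
  rsmul_mul : ∀ (x : E) (a b : A), rsmul x (a * b) = rsmul (rsmul x a) b
  inner_add : ∀ x y z : E, inner x (y + z) = inner x y + inner x z
  inner_smul : ∀ (c : ℂ) (x y : E), inner x (c • y) = c • inner x y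
  inner_rsmul : ∀ (x y : E) (a : A), inner x (rsmul y a) = inner x y * a
  star_inner : ∀ x y : E, star (inner x y) = inner y x
  inner_self_nonneg : ∀ x : E, 0 ≤ inner x x
  norm_sq_eq : ∀ x : E, ‖x‖ ^ 2 = ‖inner x x‖

/-- An `A, A`-correspondence: a Hilbert `A`-module with a left action of `A` by adjointable
operators that is a `*`-homomorphism. It may be degenerate. -/
class Correspondence (A E : Type*) [NonUnitalCStarAlgebra A] [PartialOrder A] [StarOrderedRing A]
    [NormedAddCommGroup E] [NormedSpace ℂ E] extends HilbertModule A E where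
  /-- The left action `a x`. -/
  lsmul : A → E → E
  add_lsmul : ∀ (a b : A) (x : E), lsmul (a + b) x = lsmul a x + lsmul b x
  lsmul_add : ∀ (a : A) (x y : E), lsmul a (x + y) = lsmul a x + lsmul a y
  smul_lsmul : ∀ (c : ℂ) (a : A) (x : E), lsmul (c • a) x = c • lsmul a x
  lsmul_smul : ∀ (c : ℂ) (a : A) (x : E), lsmul a (c • x) = c • lsmul a x
  mul_lsmul : ∀ (a b : A) (x : E), lsmul (a * b) x = lsmul a (lsmul b x)
  lsmul_rsmul : ∀ (a : A) (x : E) (b : A), lsmul a (rsmul x b) = rsmul (lsmul a x) b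
  inner_lsmul : ∀ (a : A) (x y : E), inner (lsmul a x) y = inner x (lsmul (star a) y)

/-- `T` has an adjoint for the `A`-valued inner products. -/
def IsAdjointable (A : Type*) {E F : Type*} [Inner A E] [Inner A F] (T : E → F) : Prop :=
  ∃ T' : F → E, ∀ x y, inner A (T x) y = inner A x (T' y)

section HilbertModule

variable {A E F : Type*} [NonUnitalCStarAlgebra A] [PartialOrder A] [StarOrderedRing A]
  [NormedAddCommGroup E] [NormedSpace ℂ E] [HilbertModule A E]
  [NormedAddCommGroup F] [NormedSpace ℂ F] [HilbertModule A F]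

open HilbertModule

theorem inner_add_left' (x y z : E) : inner A (x + y) z = inner A x z + inner A y z := by
  rw [← star_inner z (x + y), inner_add, star_add, star_inner, star_inner]

theorem inner_smul_left' (c : ℂ) (x y : E) : inner A (c • x) y = star c • inner A x y := by
  rw [← star_inner y (c • x), inner_smul, star_smul, star_inner]

theorem inner_rsmul_left' (x y : E) (a : A) :
    inner A (rsmul x a) y = star a * inner A x y := by
  rw [← star_inner y (rsmul x a), inner_rsmul, star_mul, star_inner]

theorem norm_inner_le' (x y : E) : ‖inner A x y‖ ≤ ‖x‖ * ‖y‖ := by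
  rcases eq_or_ne x 0 with h | h
  · have h0 : inner A x y = 0 := by
      have := inner_smul_left' (A := A) 0 x y
      rw [zero_smul] at this
      rw [h, this, star_zero, zero_smul]
    rw [h0, norm_zero]; positivity
  set a : A := inner A x y with ha
  set c : ℂ := ((‖x‖ ^ 2 : ℝ) : ℂ) with hc
  have hcs : star c = c := by simp [hc]
  have hyx : inner A y x = star a := by rw [ha, star_inner]
  have key : inner A (rsmul x a + (-c) • y) (rsmul x a + (-c) • y)
      = star a * inner A x x * a - c • (star a * a) - c • (star a * a)
        + c • c • inner A y y := by
    simp only [inner_add_left', inner_add, inner_smul_left', inner_smul,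
      inner_rsmul_left', inner_rsmul, hyx, ← ha]
    simp only [star_neg, hcs, neg_smul, smul_neg, mul_assoc, add_mul, neg_mul, smul_mul_assoc, smul_add,
      neg_neg]
    abel
  have h0 := inner_self_nonneg (A := A) (rsmul x a + (-c) • y)
  rw [key] at h0
  have h1 : star a * inner A x x * a ≤ c • (star a * a) := by
    have := CStarAlgebra.star_left_conjugate_le_norm_smul (a := a) (b := inner A x x)
      (by exact star_inner x x)
    rwa [← norm_sq_eq, ← Complex.coe_smul] at this
  have h2 : c • (star a * a) ≤ c • c • inner A y y := by
    rw [← sub_nonneg]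
    refine h0.trans ?_
    rw [← sub_nonneg] at h1 ⊢
    refine h1.trans_eq ?_
    abel
  have h3 := CStarAlgebra.norm_le_norm_of_nonneg_of_le
    (by rw [hc, Complex.coe_smul]; exact smul_nonneg (by positivity) (star_mul_self_nonneg a)) h2
  have hcn : ‖c‖ = ‖x‖ ^ 2 := by simp [hc]
  rw [norm_smul, norm_smul, norm_smul, CStarRing.norm_star_mul_self, hcn, ← norm_sq_eq] at h3
  have hx : 0 < ‖x‖ ^ 2 := by positivity
  have h4 := le_of_mul_le_mul_left h3 hx
  nlinarith [norm_nonneg a, norm_nonneg x, norm_nonneg y, mul_nonneg (norm_nonneg x) (norm_nonneg y)]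

theorem norm_rsmul_le (x : E) (a : A) : ‖rsmul x a‖ ≤ ‖x‖ * ‖a‖ := by
  have h : ‖rsmul x a‖ ^ 2 ≤ (‖x‖ * ‖a‖) ^ 2 := by
    rw [norm_sq_eq (A := A), inner_rsmul_left', inner_rsmul]
    calc _ ≤ ‖star a‖ * (‖inner A x x‖ * ‖a‖) :=
          (norm_mul_le _ _).trans (by gcongr; exact norm_mul_le _ _)
      _ = _ := by rw [norm_star, ← norm_sq_eq]; ring
  exact (pow_le_pow_iff_left₀ (norm_nonneg _) (by positivity) two_ne_zero).mp h

/-- The operator `|x⟩⟨y| : z ↦ x ⟪y, z⟫` from `E` to `F`. -/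
noncomputable def rankOne (A : Type*) {E F : Type*} [NonUnitalCStarAlgebra A] [PartialOrder A]
    [StarOrderedRing A] [NormedAddCommGroup E] [NormedSpace ℂ E] [HilbertModule A E]
    [NormedAddCommGroup F] [NormedSpace ℂ F] [HilbertModule A F] (x : F) (y : E) : E →L[ℂ] F :=
  LinearMap.mkContinuous
    { toFun := fun z => rsmul x (inner A y z)
      map_add' := fun z w => by rw [inner_add, rsmul_add]
      map_smul' := fun c z => by rw [inner_smul, rsmul_smul]; rfl }
    (‖x‖ * ‖y‖) (fun z => by
      refine (norm_rsmul_le x _).trans ?_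
      rw [mul_assoc]
      exact mul_le_mul_of_nonneg_left (norm_inner_le' y z) (norm_nonneg x))

/-- The space `𝕂(E, F)` of compact operators: the norm-closed linear span of the operators
`|x⟩⟨y|` with `x ∈ F`, `y ∈ E`. -/
noncomputable def compacts (A E F : Type*) [NonUnitalCStarAlgebra A] [PartialOrder A]
    [StarOrderedRing A] [NormedAddCommGroup E] [NormedSpace ℂ E] [HilbertModule A E]
    [NormedAddCommGroup F] [NormedSpace ℂ F] [HilbertModule A F] : Submodule ℂ (E →L[ℂ] F) :=
  (Submodule.span ℂ {T | ∃ (x : F) (y : E), T = rankOne A x y}).topologicalClosure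

theorem rankOne_mem_compacts (x : F) (y : E) : rankOne A x y ∈ compacts A E F :=
  Submodule.le_topologicalClosure _ (Submodule.subset_span ⟨x, y, rfl⟩)

end HilbertModule

/-! ### Weak partial product systems -/

/-- A weak partial product system `(A, E n, μ n m)` over `ℕ`.

The fibre `E 0` is identified with the identity correspondence `A` through `unit`.
An isometric bimodule map `μ n m : E n ⊗_A E m → E (n + m)` is recorded by the values
`mul x y = μ n m (x ⊗ y)` on elementary tensors. Since the inner product on the completed tensor
product is determined by
`⟪x ⊗ y, x' ⊗ y'⟫ = ⟪y, ⟪x, x'⟫ y'⟫`, such maps are exactly the bilinear balanced bimodule maps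
that satisfy `inner_mul`. The index `k` with `n + m = k` avoids casts between fibres. -/
structure WeakPartialProductSystem (A : Type*) [NonUnitalCStarAlgebra A] [PartialOrder A]
    [StarOrderedRing A] (E : ℕ → Type*) [∀ n, NormedAddCommGroup (E n)]
    [∀ n, NormedSpace ℂ (E n)] [∀ n, CompleteSpace (E n)] [∀ n, Correspondence A (E n)] where
  /-- The identification of `A` with `E 0`. -/
  unit : A ≃ₗ[ℂ] E 0
  inner_unit : ∀ a b : A, inner A (unit a) (unit b) = star a * b
  lsmul_unit : ∀ a b : A, Correspondence.lsmul a (unit b) = unit (a * b)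
  unit_rsmul : ∀ a b : A, HilbertModule.rsmul (unit a) b = unit (a * b)
  /-- The multiplication maps. -/
  mul : ∀ {n m k : ℕ}, n + m = k → (E n →ₗ[ℂ] E m →ₗ[ℂ] E k)
  mul_balanced : ∀ {n m k : ℕ} (h : n + m = k) (x : E n) (a : A) (y : E m),
    mul h (HilbertModule.rsmul x a) y = mul h x (Correspondence.lsmul a y)
  lsmul_mul : ∀ {n m k : ℕ} (h : n + m = k) (a : A) (x : E n) (y : E m),
    mul h (Correspondence.lsmul a x) y = Correspondence.lsmul a (mul h x y)
  mul_rsmul : ∀ {n m k : ℕ} (h : n + m = k) (x : E n) (y : E m) (a : A),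
    mul h x (HilbertModule.rsmul y a) = HilbertModule.rsmul (mul h x y) a
  inner_mul : ∀ {n m k : ℕ} (h : n + m = k) (x x' : E n) (y y' : E m),
    inner A (mul h x y) (mul h x' y') = inner A y (Correspondence.lsmul (inner A x x') y')
  unit_mul : ∀ {m : ℕ} (a : A) (x : E m), mul (zero_add m) (unit a) x = Correspondence.lsmul a x
  mul_unit : ∀ {m : ℕ} (x : E m) (a : A), mul (add_zero m) x (unit a) = HilbertModule.rsmul x a
  mul_assoc : ∀ {n m l p q k : ℕ} (h₁ : n + m = p) (h₂ : p + l = k) (h₃ : m + l = q)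
    (h₄ : n + q = k) (x : E n) (y : E m) (z : E l),
    mul h₂ (mul h₁ x y) z = mul h₄ x (mul h₃ y z)

/-! ### The Fock module and creation operators -/

theorem summable_of_le {A ι : Type*} [NonUnitalCStarAlgebra A] [PartialOrder A]
    [StarOrderedRing A] {a b : ι → A} (ha : ∀ i, 0 ≤ a i) (hab : ∀ i, a i ≤ b i)
    (hb : Summable b) : Summable a := by
  rw [summable_iff_vanishing_norm] at hb ⊢
  intro ε hε
  obtain ⟨s, hs⟩ := hb ε hε
  exact ⟨s, fun t ht => (CStarAlgebra.norm_le_norm_of_nonneg_of_le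
    (Finset.sum_nonneg fun i _ => ha i) (Finset.sum_le_sum fun i _ => hab i)).trans_lt (hs t ht)⟩

section Fock

variable (A : Type*) [NonUnitalCStarAlgebra A] [PartialOrder A]
    [StarOrderedRing A] (E : ℕ → Type*) [∀ n, NormedAddCommGroup (E n)]
    [∀ n, NormedSpace ℂ (E n)] [∀ n, HilbertModule A (E n)]

/-- The Fock module `⨁ E n`: the Hilbert module direct sum, that is, the space of sequences `f`
with `f n ∈ E n` for which the series `∑ ⟪f n, f n⟫` converges in norm. -/
def fock : Submodule ℂ (∀ n, E n) where
  carrier := {f | Summable fun n => inner A (f n) (f n)}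
  add_mem' := by
    intro f g hf hg
    have hf' : Summable fun n => inner A (f n) (f n) := hf
    have hg' : Summable fun n => inner A (g n) (g n) := hg
    refine summable_of_le (b := fun n => (2 : ℕ) • (inner A (f n) (f n) + inner A (g n) (g n)))
      (fun n => HilbertModule.inner_self_nonneg _) (fun n => ?_)
      ((hf'.add hg').const_smul (2 : ℕ))
    have h := HilbertModule.inner_self_nonneg (A := A) (f n + (-1 : ℂ) • g n)
    rw [← sub_nonneg]
    refine h.trans_eq ?_
    simp only [Pi.add_apply, inner_add_left', HilbertModule.inner_add, inner_smul_left',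
      HilbertModule.inner_smul]
    simp only [star_neg, star_one, neg_smul, one_smul, two_nsmul]
    abel
  zero_mem' := by
    have h : ∀ n, inner A (0 : E n) 0 = 0 := fun n => by
      have := HilbertModule.inner_smul (A := A) (0 : ℂ) (0 : E n) 0
      simpa using this
    simp only [Set.mem_ofPred_eq, Pi.zero_apply, h]
    exact summable_zero
  smul_mem' := by
    intro c f hf
    have hf' : Summable fun n => inner A (f n) (f n) := hf
    simp only [Set.mem_ofPred_eq, Pi.smul_apply, inner_smul_left', HilbertModule.inner_smul]
    exact (hf'.const_smul (star c)).const_smul c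

/-- The inner product `⟪f, g⟫ = ∑ ⟪f n, g n⟫` on the Fock module. -/
noncomputable instance fockInner : Inner A (fock A E) where
  inner f g := ∑' n, inner A (f.1 n) (g.1 n)

variable {A E}

/-- The series that defines the inner product on the Fock module converges. -/
theorem fock_summable_inner (f g : fock A E) :
    Summable fun n => inner A (f.1 n) (g.1 n) := by
  have hs : ∀ c : ℂ, Summable fun n => inner A ((f + c • g).1 n) ((f + c • g).1 n) :=
    fun c => (f + c • g).2
  have e : ∀ n, inner A (f.1 n) (g.1 n) = (1 / 4 : ℂ) •
      ((inner A ((f + (1 : ℂ) • g).1 n) ((f + (1 : ℂ) • g).1 n)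
        - inner A ((f + (-1 : ℂ) • g).1 n) ((f + (-1 : ℂ) • g).1 n))
      + (-Complex.I) • (inner A ((f + Complex.I • g).1 n) ((f + Complex.I • g).1 n)
        - inner A ((f + (-Complex.I) • g).1 n) ((f + (-Complex.I) • g).1 n))) := by
    intro n
    simp only [Submodule.coe_add, Submodule.coe_smul, Pi.add_apply, Pi.smul_apply, inner_add_left',
      HilbertModule.inner_add, inner_smul_left', HilbertModule.inner_smul]
    simp only [star_neg, star_one, RCLike.star_def, Complex.conj_I]
    match_scalars <;> ring_nf <;> simp <;> ring
  simp_rw [e]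
  exact (((hs 1).sub (hs (-1))).add (((hs _).sub (hs _)).const_smul _)).const_smul _

open Classical in
/-- The inclusion of the summand `E m` into the Fock module. -/
noncomputable def fockOf (m : ℕ) (y : E m) : fock A E :=
  ⟨Pi.single m y, by
    refine summable_of_ne_finset_zero (s := {m}) fun n hn => ?_
    have hnm : n ≠ m := by simpa using hn
    rw [Pi.single_eq_of_ne hnm]
    have := HilbertModule.inner_smul (A := A) (0 : ℂ) (0 : E n) 0
    simpa using this⟩

open Classical in
theorem inner_fockOf (f : fock A E) (m : ℕ) (y : E m) :
    inner A f (fockOf m y) = inner A (f.1 m) y := by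
  have h0 : ∀ {n} (z : E n), inner A z (0 : E n) = 0 := fun z => by
    simpa using HilbertModule.inner_smul (A := A) (0 : ℂ) z 0
  change ∑' n, inner A (f.1 n) ((Pi.single m y : ∀ n, E n) n) = _
  rw [tsum_eq_single m]
  · rw [Pi.single_eq_same]
  · intro n hn
    rw [Pi.single_eq_of_ne hn, h0]

theorem fockOf_inner (f : fock A E) (m : ℕ) (y : E m) :
    inner A (fockOf m y) f = inner A y (f.1 m) := by
  have h : star (inner A f (fockOf m y)) = inner A (fockOf m y) f := by
    change star (∑' n, _) = ∑' n, _
    rw [tsum_star]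
    exact tsum_congr fun n => HilbertModule.star_inner _ _
  rw [← h, inner_fockOf, HilbertModule.star_inner]

end Fock

namespace WeakPartialProductSystem

variable {A : Type*} [NonUnitalCStarAlgebra A] [PartialOrder A]
    [StarOrderedRing A] {E : ℕ → Type*} [∀ n, NormedAddCommGroup (E n)]
    [∀ n, NormedSpace ℂ (E n)] [∀ n, CompleteSpace (E n)] [∀ n, Correspondence A (E n)]

/-- A positive `b` acts with `⟪y, b y⟫ ≤ ‖b‖ ⟪y, y⟫`. -/
theorem inner_lsmul_le {F : Type*} [NormedAddCommGroup F] [NormedSpace ℂ F] [Correspondence A F]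
    (b : A) (hb : 0 ≤ b) (y : F) :
    inner A y (Correspondence.lsmul b y) ≤ ‖b‖ • inner A y y := by
  rcases eq_or_ne b 0 with h0 | h0
  · have h1 : Correspondence.lsmul (0 : A) y = 0 := by
      have := Correspondence.smul_lsmul (0 : ℂ) (0 : A) y
      simpa using this
    have h2 := HilbertModule.inner_smul (A := A) (0 : ℂ) y y
    rw [zero_smul, zero_smul] at h2
    rw [h0, h1, h2]; simp
  have hc : 0 < ‖b‖ := norm_pos_iff.mpr h0
  have hbs : IsSelfAdjoint b := .of_nonneg hb
  set s : A := cfcₙ (fun t : ℝ => 1 - √(1 - t / ‖b‖)) b with hs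
  have hss : star s = s := (cfcₙ_predicate (R := ℝ) (p := IsSelfAdjoint) _ b).star_eq
  have key : ‖b‖ • (s + s - s * s) = b := by
    have hcont : ContinuousOn (fun t : ℝ => 1 - √(1 - t / ‖b‖)) (quasispectrum ℝ b) := by fun_prop
    rw [hs, ← cfcₙ_add (a := b) _ _, ← cfcₙ_mul (a := b) _ _, ← cfcₙ_sub (a := b) _ _,
      ← cfcₙ_smul (a := b) _ _]
    conv_rhs => rw [← cfcₙ_id' ℝ b]
    refine cfcₙ_congr fun t ht => ?_
    have ht1 : t ≤ ‖b‖ :=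
      (Real.le_norm_self t).trans (NonUnitalIsometricContinuousFunctionalCalculus.norm_quasispectrum_le b ht hbs)
    have h1 : 0 ≤ 1 - t / ‖b‖ := by
      rw [sub_nonneg, div_le_one hc]; exact ht1
    have h2 := Real.mul_self_sqrt h1
    simp only [smul_eq_mul]
    have h3 : (1 - √(1 - t / ‖b‖) + (1 - √(1 - t / ‖b‖)) -
        (1 - √(1 - t / ‖b‖)) * (1 - √(1 - t / ‖b‖))) = t / ‖b‖ := by nlinarith
    rw [h3]; field_simp
  have hpos := HilbertModule.inner_self_nonneg (A := A) (y + (-1 : ℂ) • Correspondence.lsmul s y)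
  have e : ‖b‖ • inner A (y + (-1 : ℂ) • Correspondence.lsmul s y)
      (y + (-1 : ℂ) • Correspondence.lsmul s y)
      = ‖b‖ • inner A y y - inner A y (Correspondence.lsmul b y) := by
    have hr : Correspondence.lsmul b y = (‖b‖ : ℂ) • (Correspondence.lsmul s y
        + Correspondence.lsmul s y + (-1 : ℂ) • Correspondence.lsmul s (Correspondence.lsmul s y)) := by
      conv_lhs => rw [← key]
      rw [← Complex.coe_smul, Correspondence.smul_lsmul, sub_eq_add_neg, Correspondence.add_lsmul,
        Correspondence.add_lsmul, ← Correspondence.mul_lsmul, ← Correspondence.smul_lsmul]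
      simp
    rw [hr]
    simp only [inner_add_left', HilbertModule.inner_add, inner_smul_left',
      HilbertModule.inner_smul, Correspondence.inner_lsmul, hss]
    simp only [star_neg, star_one, neg_smul, one_smul, neg_neg, smul_neg, Complex.coe_smul,
      smul_add]
    abel
  rw [← sub_nonneg, ← e]
  exact smul_nonneg hc.le hpos

/-- The creation operator `S n x = ∑ S n m x` on the Fock module, where
`S n m x : E m → E (n + m)` is `y ↦ x y`. -/
noncomputable def creation (P : WeakPartialProductSystem A E) (n : ℕ) (x : E n)
    (f : fock A E) : fock A E :=
  ⟨fun k => if h : n ≤ k then P.mul (Nat.add_sub_of_le h) x (f.1 (k - n)) else 0, by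
    change Summable _
    rw [← summable_nat_add_iff n]
    refine summable_of_le (b := fun k => ‖inner A x x‖ • inner A (f.1 k) (f.1 k))
      (fun k => HilbertModule.inner_self_nonneg _) (fun k => ?_) (f.2.const_smul _)
    have hk : n ≤ k + n := Nat.le_add_left n k
    have hf : inner A (f.1 (k + n - n)) (f.1 (k + n - n)) = inner A (f.1 k) (f.1 k) :=
      congrArg (fun j => inner A (f.1 j) (f.1 j)) (Nat.add_sub_cancel k n)
    simp only [dif_pos hk]
    rw [P.inner_mul, ← hf]
    exact inner_lsmul_le _ (HilbertModule.inner_self_nonneg x) _⟩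

/-- The weak Fock representation exists: all creation operators are adjointable. -/
def FockExists (P : WeakPartialProductSystem A E) : Prop :=
  ∀ (n : ℕ) (x : E n), IsAdjointable A (P.creation n x)

/-- The annihilation operator `(S n x)⋆` on the Fock module. -/
noncomputable def annihilation {P : WeakPartialProductSystem A E} (hP : P.FockExists)
    (n : ℕ) (x : E n) : fock A E → fock A E :=
  Classical.choose (hP n x)

theorem inner_creation {P : WeakPartialProductSystem A E} (hP : P.FockExists)
    (n : ℕ) (x : E n) (f g : fock A E) :
    inner A (P.creation n x f) g = inner A f (annihilation hP n x g) :=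
  Classical.choose_spec (hP n x) f g

open Classical in
/-- For `y ∈ E m` and `n ≤ m`, the vector `(S n x)⋆ y` lies in the summand `E (m - n)`. -/
theorem annihilation_fockOf {P : WeakPartialProductSystem A E} (hP : P.FockExists)
    {n m : ℕ} (hnm : n ≤ m) (x : E n) (y : E m) :
    annihilation hP n x (fockOf m y) =
      fockOf (m - n) ((annihilation hP n x (fockOf m y)).1 (m - n)) := by
  ext k
  by_cases hk : k = m - n
  · subst hk
    change _ = (Pi.single (m - n) _ : ∀ n, E n) (m - n)
    rw [Pi.single_eq_same]
  · change _ = (Pi.single (m - n) _ : ∀ n, E n) k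
    rw [Pi.single_eq_of_ne hk]
    set w := (annihilation hP n x (fockOf m y)).1 k with hw
    have h1 : inner A w w = 0 := by
      have h2 := inner_creation hP n x (fockOf k w) (fockOf m y)
      rw [fockOf_inner, inner_fockOf, ← hw] at h2
      rw [← h2]
      have h3 : (P.creation n x (fockOf k w)).1 m = 0 := by
        change (if h : n ≤ m then P.mul (Nat.add_sub_of_le h) x
          ((Pi.single k w : ∀ n, E n) (m - n)) else 0) = 0
        rw [dif_pos hnm, Pi.single_eq_of_ne (Ne.symm hk), map_zero]
      rw [h3]
      simpa using inner_smul_left' (A := A) (0 : ℂ) (0 : E m) y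
    have h4 := HilbertModule.norm_sq_eq (A := A) w
    rw [h1, norm_zero] at h4
    exact norm_eq_zero.mp (pow_eq_zero_iff two_ne_zero |>.mp h4)

/-- The element `(S n x)⋆ y ∈ E (m - n)` for `x ∈ E n` and `y ∈ E m` with `n ≤ m`. -/
noncomputable def annihilate {P : WeakPartialProductSystem A E} (hP : P.FockExists)
    {n m : ℕ} (x : E n) (y : E m) : E (m - n) :=
  (annihilation hP n x (fockOf m y)).1 (m - n)

end WeakPartialProductSystem

/-! ### Weak representations and representations -/

/-- The product `X · Y`: the closed linear span of the products `x y` with `x ∈ X`, `y ∈ Y`. -/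
def closedMul {B : Type*} [NonUnitalCStarAlgebra B] (X Y : Set B) : Set B :=
  closure (Submodule.span ℂ (Set.image2 (fun x y => x * y) X Y) : Set B)

section Representation

variable {A : Type*} [NonUnitalCStarAlgebra A] [PartialOrder A]
    [StarOrderedRing A] {E : ℕ → Type*} [∀ n, NormedAddCommGroup (E n)]
    [∀ n, NormedSpace ℂ (E n)] [∀ n, CompleteSpace (E n)] [∀ n, Correspondence A (E n)]

/-- A weak representation `(ω n)` of a weak partial product system in a C*-algebra `B`. -/
structure WeakRepresentation (P : WeakPartialProductSystem A E) (B : Type*)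
    [NonUnitalCStarAlgebra B] where
  /-- The linear maps `ω n : E n → B`. -/
  map : ∀ n, E n →ₗ[ℂ] B
  map_mul_map : ∀ (n m : ℕ) (x : E n) (y : E m),
    map n x * map m y = map (n + m) (P.mul rfl x y)
  star_map_mul_map : ∀ (n : ℕ) (x y : E n),
    star (map n x) * map n y = map 0 (P.unit (inner A x y))

variable {P : WeakPartialProductSystem A E} {B : Type*} [NonUnitalCStarAlgebra B]

namespace WeakRepresentation

/-- The subspace `ω n (E n)` of `B`. -/
def img (ω : WeakRepresentation P B) (n : ℕ) : Set B := Set.range (ω.map n)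

/-- The subspace `ω n (E n)⋆` of `B`. -/
def imgStar (ω : WeakRepresentation P B) (n : ℕ) : Set B := Set.range fun x => star (ω.map n x)

/-- A weak representation is a representation if it satisfies two inclusions. -/
structure IsRepresentation (ω : WeakRepresentation P B) : Prop where
  subset_of_lt : ∀ n m : ℕ, 0 < n → n < m →
    closedMul (ω.imgStar n) (ω.img m) ⊆ closedMul (ω.img (m - n)) Set.univ
  subset_of_gt : ∀ n m : ℕ, 0 < m → m < n →
    closedMul (ω.imgStar n) (ω.img m) ⊆ closedMul (ω.imgStar (n - m)) Set.univ

/-- The family `Θ m n : 𝕂(E m, E n) → B` of bounded linear maps satisfies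
`Θ m n (|x⟩⟨y|) = ω n (x) (ω m (y))⋆`. -/
def IsTheta (ω : WeakRepresentation P B)
    (Θ : ∀ m n : ℕ, compacts A (E m) (E n) →L[ℂ] B) : Prop :=
  ∀ (m n : ℕ) (x : E n) (y : E m),
    Θ m n ⟨rankOne A x y, rankOne_mem_compacts x y⟩ = ω.map n x * star (ω.map m y)

end WeakRepresentation

end Representation

end PPS

namespace PPS

/-! ### Functional calculus in C*-algebras -/

section CStar

variable {D B : Type*} [NonUnitalCStarAlgebra D] [NonUnitalCStarAlgebra B]

/-! The existence of `Θ` rests on a spectral radius argument. If `T = ∑ |xᵢ⟩⟨yᵢ|` and `b = ∑ ω n xᵢ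
(ω m yᵢ)⋆`, then `b * ω m z = ω n (T z)`, and `b⋆` is related to `T⋆` in the same way. Hence
multiplying `b⋆b` repeatedly by itself only applies powers of `T⋆T` to finitely many vectors, so the
powers grow at most like `C ‖T⋆T‖ ^ k`. The C*-identity turns this into `‖b‖ ≤ ‖T‖`
(`norm_le_of_mem_thetaGraph`), so the closed span of the pairs `(T, b)` is the graph of a
contraction on all compact operators.

The core of the equivalence is `star_map_mul_map_eq_annihilate`. Let `d` be the difference of `(ω n
x)⋆ ω m y` and `ω (m - n) ((S n x)⋆ y)`. Adjointness of creation and annihilation always gives `d⋆ ω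
(m - n) w = 0`. If moreover `d B` lies in `ω (m - n) (E (m - n)) · B`, then `d⋆ d B = 0` and `d =
0`. So an inclusion that holds only after multiplication by `B` already forces the exact formula.
Taking adjoints exchanges the conditions for `n < m` and `m < n`.

Two facts support this. The ranges of `ω n` and `Θ m n` are closed (`isClosed_range_of_quadratic`),
so that they contain closed linear spans of their elements. Every vector is a limit of vectors `x d`
(`exists_norm_sub_act_le`), which replaces the missing units. In the condition on `Θ`, the middle
product of `ω n x (ω m y)⋆ ω q z (ω p w)⋆` collapses to a single `ω` or its adjoint; conversely, `Θ
n 0` and `Θ 0 m` recover `(ω n x)⋆` and `ω m y` up to factors from `ω 0`. -/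

theorem norm_compress_cfcₙ_le {h : D} (hh : IsSelfAdjoint h) {g : ℝ → ℝ} (hg : Continuous g)
    (hg0 : g 0 = 0) {c : ℝ} (hc : ∀ t, |t * (1 - g t) ^ 2| ≤ c) :
    ‖h - cfcₙ g h * h - h * cfcₙ g h + cfcₙ g h * h * cfcₙ g h‖ ≤ c := by
  have hgc : ContinuousOn g (quasispectrum ℝ h) := hg.continuousOn
  have hic : ContinuousOn (fun t : ℝ => t) (quasispectrum ℝ h) := continuousOn_id
  -- This is `(1 - g(h)) h (1 - g(h))`, expanded because the algebra need not have a unit.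
  have e : h - cfcₙ g h * h - h * cfcₙ g h + cfcₙ g h * h * cfcₙ g h
      = cfcₙ (fun t => t - g t * t - t * g t + g t * t * g t) h := by
    have h1 : cfcₙ (fun t => g t * t) h = cfcₙ g h * h := by
      rw [cfcₙ_mul g (fun t => t) h, cfcₙ_id' ℝ h]
    have h2 : cfcₙ (fun t => t * g t) h = h * cfcₙ g h := by
      rw [cfcₙ_mul (fun t => t) g h, cfcₙ_id' ℝ h]
    rw [cfcₙ_add (fun t => t - g t * t - t * g t) (fun t => g t * t * g t) h
        (by fun_prop) (by simp) (by fun_prop) (by simp),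
      cfcₙ_sub (fun t => t - g t * t) (fun t => t * g t) h
        (by fun_prop) (by simp) (by fun_prop) (by simp),
      cfcₙ_sub (fun t => t) (fun t => g t * t) h (by fun_prop) (by simp) (by fun_prop) (by simp),
      cfcₙ_mul (fun t => g t * t) g h (by fun_prop) (by simp) (by fun_prop) hg0,
      h1, h2, cfcₙ_id' ℝ h]
  rw [e]
  refine norm_cfcₙ_le fun t _ => ?_
  rw [Real.norm_eq_abs]
  convert hc t using 2
  ring

/-- A vector of a module with a quadratic map `q x = ⟪x, x⟫` into a C*-algebra is a limit of
vectors `x d`. -/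
theorem exists_norm_sub_act_le {V : Type*} [NormedAddCommGroup V]
    {q : V → D} {act : V → D → V} (hq : ∀ x, IsSelfAdjoint (q x)) (hn : ∀ x, ‖x‖ ^ 2 = ‖q x‖)
    (hact : ∀ x d, IsSelfAdjoint d →
      q (x - act x d) = q x - d * q x - q x * d + d * q x * d)
    (x : V) {ε : ℝ} (hε : 0 < ε) : ∃ d, ‖x - act x d‖ ≤ ε := by
  -- The factor `1 - g` vanishes where `|t| ≥ ε²`, and elsewhere `|t|` itself is at most `ε²`. Hence
  -- `q (x - x d)` has norm at most `ε²`.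
  set g : ℝ → ℝ := fun t => min 1 (|t| / ε ^ 2) with hg
  refine ⟨cfcₙ g (q x), ?_⟩
  have hgc : Continuous g := by fun_prop
  have hε2 : 0 < ε ^ 2 := by positivity
  have h1 := norm_compress_cfcₙ_le (hq x) hgc (by simp [hg]) (c := ε ^ 2) (fun t => by
    rw [abs_mul, abs_of_nonneg (sq_nonneg (1 - g t))]
    rcases le_total 1 (|t| / ε ^ 2) with h | h
    · simp only [hg, min_eq_left h]; simp; positivity
    · simp only [hg, min_eq_right h]
      have h2 : |t| ≤ ε ^ 2 := (div_le_one hε2).mp h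
      have h3 : 0 ≤ |t| / ε ^ 2 := by positivity
      calc |t| * (1 - |t| / ε ^ 2) ^ 2 ≤ ε ^ 2 * 1 := by
            gcongr
            exact pow_le_one₀ (by linarith) (by linarith)
        _ = ε ^ 2 := mul_one _)
  rw [← hact x _ (cfcₙ_predicate (R := ℝ) (p := IsSelfAdjoint) _ _), ← hn] at h1
  exact (pow_le_pow_iff_left₀ (norm_nonneg _) hε.le two_ne_zero).mp h1

/-- A map of Hilbert modules along a `*`-homomorphism of C*-algebras has closed range. -/
theorem isClosed_range_of_quadratic {V : Type*} [NormedAddCommGroup V] [NormedSpace ℂ V]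
    [CompleteSpace V] (φ : D →⋆ₙₐ[ℂ] B) (ρ : V →L[ℂ] B) {q : V → D} {act : V → D → V}
    (hq : ∀ x, IsSelfAdjoint (q x)) (hn : ∀ x, ‖x‖ ^ 2 = ‖q x‖)
    (hact : ∀ x d, IsSelfAdjoint d →
      q (x - act x d) = q x - d * q x - q x * d + d * q x * d)
    (hρ : ∀ x d, ρ (act x d) = ρ x * φ d) (hρq : ∀ x, star (ρ x) * ρ x = φ (q x)) :
    IsClosed (Set.range ρ) := by
  -- Every element of the range has a preimage of no larger norm; completeness of `V` then makes the
  -- range closed.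
  have lift : ∀ x, ∃ x', ρ x' = ρ x ∧ ‖x'‖ ≤ ‖ρ x‖ := by
    intro x
    rcases eq_or_ne (ρ x) 0 with h0 | h0
    · exact ⟨0, by rw [h0, map_zero], by simp⟩
    set r := ‖ρ x‖ with hr
    have hr0 : 0 < r := norm_pos_iff.mpr h0
    have hr2 : 0 < r ^ 2 := by positivity
    -- The corrected vector `x - x g(q x)` has `q` equal to `t r² / max |t| r²` evaluated at `q x`,
    -- of norm at most `r²`. Since `g` vanishes on `[-r², r²]`, which contains the spectrum of `φ (q
    -- x) = (ρ x)⋆ ρ x`, the correction is invisible to `ρ`.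
    set g : ℝ → ℝ := fun t => 1 - r / √(max |t| (r ^ 2)) with hg
    have hpos : ∀ t : ℝ, 0 < max |t| (r ^ 2) := fun t => lt_max_of_lt_right hr2
    have hgc : Continuous g := by
      refine continuous_const.sub (continuous_const.div (by fun_prop) fun t => ?_)
      exact (Real.sqrt_pos.mpr (hpos t)).ne'
    have hgz : ∀ t, |t| ≤ r ^ 2 → g t = 0 := fun t ht => by
      simp only [hg]
      rw [max_eq_right ht, Real.sqrt_sq hr0.le, div_self hr0.ne', sub_self]
    have hg0 : g 0 = 0 := hgz 0 (by simpa using hr2.le)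
    have h1 := norm_compress_cfcₙ_le (hq x) hgc hg0 (c := r ^ 2) (fun t => by
      rw [abs_mul, abs_of_nonneg (sq_nonneg (1 - g t))]
      simp only [hg, sub_sub_cancel, div_pow, Real.sq_sqrt (hpos t).le]
      rw [mul_div_assoc', div_le_iff₀ (hpos t), mul_comm]
      gcongr
      exact le_max_left _ _)
    rw [← hact x _ (cfcₙ_predicate (R := ℝ) (p := IsSelfAdjoint) _ _), ← hn] at h1
    refine ⟨_, ?_, (pow_le_pow_iff_left₀ (norm_nonneg _) hr0.le two_ne_zero).mp h1⟩
    have hsa : IsSelfAdjoint (φ (q x)) := by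
      rw [← hρq]; exact .star_mul_self _
    have hφ : φ (cfcₙ g (q x)) = 0 := by
      rw [NonUnitalStarAlgHomClass.map_cfcₙ φ g (q x) hgc.continuousOn hg0
        (AddMonoidHomClass.continuous_of_bound φ 1 fun a => by
          simpa using NonUnitalStarAlgHom.norm_apply_le φ a) (hq x) hsa]
      rw [← norm_le_zero_iff]
      refine norm_cfcₙ_le fun t ht => ?_
      rw [hgz t, norm_zero]
      have := NonUnitalIsometricContinuousFunctionalCalculus.norm_quasispectrum_le _ ht hsa
      rwa [← hρq, CStarRing.norm_star_mul_self, ← sq, Real.norm_eq_abs] at this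
    rw [map_sub, hρ, hφ, mul_zero, sub_zero]
  set f : NormedAddGroupHom V B := ρ.toLinearMap.toAddMonoidHom.mkNormedAddGroupHom ‖ρ‖
    ρ.le_opNorm with hf
  have hs : f.SurjectiveOnWith f.range 1 := by
    rintro _ ⟨x, rfl⟩
    obtain ⟨x', h1, h2⟩ := lift x
    exact ⟨x', h1, by rw [one_mul]; exact h2⟩
  have hcl := controlled_closure_of_complete one_pos one_pos hs
  rw [← closure_subset_iff_isClosed]
  intro b hb
  obtain ⟨x, hx, -⟩ := hcl b (by exact hb)
  exact ⟨x, hx⟩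

/-- In a C*-algebra, `b` is a limit of elements `b d`. -/
theorem exists_norm_sub_mul_le (b : B) {ε : ℝ} (hε : 0 < ε) : ∃ d, ‖b - b * d‖ ≤ ε :=
  exists_norm_sub_act_le (q := fun b : B => star b * b) (act := fun b d => b * d)
    (fun b => .star_mul_self b) (fun b => by rw [CStarRing.norm_star_mul_self, sq])
    (fun x d hd => by
      simp only [star_sub, star_mul, hd.star_eq]
      noncomm_ring) b hε

/-- A norm bound for a self-adjoint element from the growth of its powers. -/
theorem norm_le_of_iterate_mul_le {a : B} (ha : IsSelfAdjoint a) {C M : ℝ} (hM : 0 ≤ M)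
    (h : ∀ k : ℕ, ‖(fun c => a * c)^[k] a‖ ≤ C * M ^ k) : ‖a‖ ≤ M := by
  set u : Unitization ℂ B := (a : Unitization ℂ B) with hu
  have hus : IsSelfAdjoint u := by
    rw [IsSelfAdjoint, hu, ← Unitization.inr_star, ha.star_eq]
  have hpow : ∀ k : ℕ, u ^ (k + 1) = (((fun c => a * c)^[k] a : B) : Unitization ℂ B) := by
    intro k
    induction k with
    | zero => simp [hu]
    | succ k ih => rw [pow_succ', ih, Function.iterate_succ_apply', hu, ← Unitization.inr_mul]
  have hn : ∀ j : ℕ, ‖a‖ ^ 2 ^ j ≤ C * M ^ (2 ^ j - 1) := by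
    intro j
    have h1 := hus.norm_pow_two_pow j
    rw [hu, Unitization.norm_inr, ← hu] at h1
    rw [← h1]
    obtain ⟨k, hk⟩ : ∃ k, 2 ^ j = k + 1 := Nat.exists_eq_add_one.mpr (by positivity)
    rw [hk, hpow, Unitization.norm_inr, Nat.add_sub_cancel]
    exact h k
  by_contra hlt
  rw [not_le] at hlt
  rcases hM.eq_or_lt with h0 | h0
  -- With `M = 0` the exponent `2 ^ j - 1` must be positive, so `j = 1` is used instead of `j = 0`.
  · have := hn 1
    rw [← h0] at this
    simp only [pow_one, Nat.add_one_sub_one, mul_zero] at this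
    nlinarith [pow_pos (hM.trans_lt hlt) 2]
  · have h1 : 1 < ‖a‖ / M := (one_lt_div h0).mpr hlt
    obtain ⟨j, hj⟩ := ((tendsto_pow_atTop_atTop_of_one_lt h1).comp
      (tendsto_pow_atTop_atTop_of_one_lt (one_lt_two (α := ℕ)))).eventually_gt_atTop
        (C / M) |>.exists
    have h2 := hn j
    obtain ⟨k, hk⟩ : ∃ k, 2 ^ j = k + 1 := Nat.exists_eq_add_one.mpr (by positivity)
    simp only [Function.comp_apply] at hj
    rw [hk] at h2 hj
    rw [Nat.add_sub_cancel] at h2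
    rw [div_pow, div_lt_div_iff₀ h0 (by positivity), pow_succ M] at hj
    nlinarith

end CStar

/-! ### Closed products of subsets -/

section ClosedMul

variable {B : Type*} [NonUnitalCStarAlgebra B]

theorem mul_mem_closedMul {X Y : Set B} {x y : B} (hx : x ∈ X) (hy : y ∈ Y) :
    x * y ∈ closedMul X Y :=
  subset_closure (Submodule.subset_span ⟨x, hx, y, hy, rfl⟩)

theorem closedMul_subset {X Y : Set B} (M : Submodule ℂ B) (hM : IsClosed (M : Set B))
    (h : ∀ x ∈ X, ∀ y ∈ Y, x * y ∈ M) : closedMul X Y ⊆ M := by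
  refine closure_minimal (Submodule.span_le.mpr ?_) hM
  rintro _ ⟨x, hx, y, hy, rfl⟩
  exact h x hx y hy

/-- The product `X · Y` as a subspace. -/
def closedMulSubmodule (X Y : Set B) : Submodule ℂ B :=
  (Submodule.span ℂ (Set.image2 (fun x y => x * y) X Y)).topologicalClosure

theorem coe_closedMulSubmodule (X Y : Set B) :
    (closedMulSubmodule X Y : Set B) = closedMul X Y := rfl

theorem isClosed_closedMulSubmodule (X Y : Set B) :
    IsClosed (closedMulSubmodule X Y : Set B) := Submodule.isClosed_topologicalClosure _

theorem closedMul_subset_closedMul {X Y X' Y' : Set B}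
    (h : ∀ x ∈ X, ∀ y ∈ Y, x * y ∈ closedMul X' Y') : closedMul X Y ⊆ closedMul X' Y' :=
  closedMul_subset (closedMulSubmodule X' Y') (isClosed_closedMulSubmodule X' Y') h

theorem closedMul_mono {X Y X' Y' : Set B} (hX : X ⊆ X') (hY : Y ⊆ Y') :
    closedMul X Y ⊆ closedMul X' Y' :=
  closedMul_subset_closedMul fun _ hx _ hy => mul_mem_closedMul (hX hx) (hY hy)

theorem star_mem_closedMul {X Y X' Y' : Set B} (hX : ∀ x ∈ X, star x ∈ X')
    (hY : ∀ y ∈ Y, star y ∈ Y') {c : B} (hc : c ∈ closedMul X Y) :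
    star c ∈ closedMul Y' X' := by
  let M : Submodule ℂ B :=
    { carrier := {c | star c ∈ closedMulSubmodule Y' X'}
      add_mem' := fun {a b} ha hb => by
        simp only [Set.mem_ofPred_eq, star_add] at *; exact add_mem ha hb
      zero_mem' := by simp
      smul_mem' := fun z a ha => by
        simp only [Set.mem_ofPred_eq, star_smul] at *; exact Submodule.smul_mem _ _ ha }
  refine closedMul_subset M ((isClosed_closedMulSubmodule Y' X').preimage continuous_star) ?_ hc
  intro x hx y hy
  change star (x * y) ∈ closedMul Y' X'
  rw [star_mul]
  exact mul_mem_closedMul (hY y hy) (hX x hx)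

theorem mul_right_mem_closedMul {X Y Y' : Set B} {c b : B}
    (hY : ∀ y ∈ Y, y * b ∈ Y') (hc : c ∈ closedMul X Y) : c * b ∈ closedMul X Y' := by
  refine closedMul_subset ((closedMulSubmodule X Y').comap (LinearMap.mulRight ℂ b))
    ((isClosed_closedMulSubmodule X Y').preimage (continuous_mul_const b)) ?_ hc
  intro x hx y hy
  change x * y * b ∈ closedMul X Y'
  rw [mul_assoc]
  exact mul_mem_closedMul hx (hY y hy)

/-- Without a unit in `B`, `x` is still a limit of products `x d`. -/
theorem mem_closedMul_univ {X : Set B} {x : B} (hx : x ∈ X) : x ∈ closedMul X Set.univ := by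
  rw [← coe_closedMulSubmodule, ← (isClosed_closedMulSubmodule X Set.univ).closure_eq]
  refine Metric.mem_closure_iff.mpr ?_
  intro ε hε
  obtain ⟨d, hd⟩ := exists_norm_sub_mul_le x (half_pos hε)
  exact ⟨x * d, mul_mem_closedMul hx trivial, by rw [dist_eq_norm]; linarith⟩

end ClosedMul

/-! ### Adjoints and compact operators -/

section Adjoint

variable {A E F G : Type*} [NonUnitalCStarAlgebra A] [PartialOrder A] [StarOrderedRing A]
  [NormedAddCommGroup E] [NormedSpace ℂ E] [HilbertModule A E]
  [NormedAddCommGroup F] [NormedSpace ℂ F] [HilbertModule A F]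
  [NormedAddCommGroup G] [NormedSpace ℂ G] [HilbertModule A G]

open HilbertModule

theorem inner_sub_right' (x y z : E) : inner A x (y - z) = inner A x y - inner A x z := by
  rw [eq_sub_iff_add_eq, ← inner_add, sub_add_cancel]

theorem inner_sub_left' (x y z : E) : inner A (x - y) z = inner A x z - inner A y z := by
  rw [eq_sub_iff_add_eq, ← inner_add_left', sub_add_cancel]

theorem continuous_inner_right (x : E) : Continuous fun y : E => inner A x y := by
  refine (LinearMap.mkContinuous
    ({ toFun := fun y : E => inner A x y
       map_add' := fun y z => inner_add x y z
       map_smul' := fun c y => inner_smul c x y } : E →ₗ[ℂ] A) ‖x‖ fun y => norm_inner_le' x y).continuous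

theorem continuous_inner_left (y : E) : Continuous fun x : E => inner A x y := by
  have h : (fun x : E => inner A x y) = fun x => star (inner A y x) :=
    funext fun x => (star_inner y x).symm
  rw [h]
  exact continuous_star.comp (continuous_inner_right y)

theorem inner_isSelfAdjoint (x : E) : IsSelfAdjoint (inner A x x) := star_inner x x

theorem ext_inner_left' {x y : E} (h : ∀ z, inner A z x = inner A z y) : x = y := by
  rw [← sub_eq_zero, ← norm_eq_zero, ← pow_eq_zero_iff two_ne_zero, norm_sq_eq (A := A),
    inner_sub_right', h, sub_self, norm_zero]

theorem inner_sub_rsmul (x : E) {d : A} (hd : IsSelfAdjoint d) :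
    inner A (x - rsmul x d) (x - rsmul x d)
      = inner A x x - d * inner A x x - inner A x x * d + d * inner A x x * d := by
  simp only [inner_sub_right', inner_sub_left', inner_rsmul, inner_rsmul_left', hd.star_eq]
  noncomm_ring

variable (A) in
/-- `T` is the adjoint of `S`. -/
def IsAdjointPair (S : E →L[ℂ] F) (T : F →L[ℂ] E) : Prop :=
  ∀ x y, inner A (S x) y = inner A x (T y)

namespace IsAdjointPair

variable {S S' : E →L[ℂ] F} {T T' : F →L[ℂ] E}

theorem symm (h : IsAdjointPair A S T) : IsAdjointPair A T S := fun x y => by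
  rw [← star_inner, ← h, star_inner]

theorem add (h : IsAdjointPair A S T) (h' : IsAdjointPair A S' T') :
    IsAdjointPair A (S + S') (T + T') := fun x y => by
  simp only [add_apply, inner_add, inner_add_left', h x y, h' x y]

theorem zero : IsAdjointPair A (0 : E →L[ℂ] F) 0 := fun x y => by
  have h1 := inner_smul_left' (A := A) 0 (0 : F) y
  have h2 := inner_smul (A := A) 0 x (0 : E)
  simp only [zero_smul, star_zero] at h1 h2
  rw [zero_apply, zero_apply, h1, h2]

theorem smul (h : IsAdjointPair A S T) (c : ℂ) : IsAdjointPair A (c • S) (star c • T) :=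
  fun x y => by
    simp only [smul_apply, inner_smul, inner_smul_left', h x y]

theorem sub (h : IsAdjointPair A S T) (h' : IsAdjointPair A S' T') :
    IsAdjointPair A (S - S') (T - T') := fun x y => by
  simp only [sub_apply, inner_sub_right', inner_sub_left', h x y, h' x y]

theorem comp {U : F →L[ℂ] G} {V : G →L[ℂ] F} (h : IsAdjointPair A S T)
    (h' : IsAdjointPair A U V) : IsAdjointPair A (U ∘L S) (T ∘L V) := fun x y => by
  rw [ContinuousLinearMap.comp_apply, h', h, ContinuousLinearMap.comp_apply]

theorem unique (h : IsAdjointPair A S T) (h' : IsAdjointPair A S T') : T = T' :=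
  ContinuousLinearMap.ext fun y => ext_inner_left' (A := A) fun z => by rw [← h, ← h']

/-- Inner products separate vectors, so adjointability alone forces `A`-linearity. -/
theorem map_rsmul (h : IsAdjointPair A S T) (x : E) (a : A) :
    S (rsmul x a) = rsmul (S x) a :=
  ext_inner_left' (A := A) fun z => by rw [← h.symm, inner_rsmul, inner_rsmul, h.symm]

theorem norm_le (h : IsAdjointPair A S T) : ‖T‖ ≤ ‖S‖ := by
  refine T.opNorm_le_bound (norm_nonneg _) fun y => ?_
  rcases (norm_nonneg (T y)).eq_or_lt with h0 | h0
  · rw [← h0]; positivity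
  refine le_of_mul_le_mul_left ?_ h0
  calc ‖T y‖ * ‖T y‖ = ‖inner A (T y) (T y)‖ := by rw [← HilbertModule.norm_sq_eq, sq]
    _ = ‖inner A (S (T y)) y‖ := by rw [h]
    _ ≤ ‖S (T y)‖ * ‖y‖ := norm_inner_le' _ _
    _ ≤ ‖S‖ * ‖T y‖ * ‖y‖ := by gcongr; exact S.le_opNorm _
    _ = _ := by ring

/-- The C*-identity for operators between two different modules. Cauchy–Schwarz gives one inequality
and `‖T‖ ≤ ‖S‖` the other. -/
theorem norm_sq_eq (h : IsAdjointPair A S T) : ‖S‖ ^ 2 = ‖T ∘L S‖ := by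
  refine le_antisymm ?_ ?_
  · rw [← Real.le_sqrt (norm_nonneg _) (norm_nonneg _)]
    refine S.opNorm_le_bound (Real.sqrt_nonneg _) fun x => ?_
    rw [← pow_le_pow_iff_left₀ (norm_nonneg _) (by positivity) two_ne_zero, mul_pow,
      Real.sq_sqrt (norm_nonneg _), HilbertModule.norm_sq_eq (A := A), h]
    calc _ ≤ ‖x‖ * ‖(T ∘L S) x‖ := norm_inner_le' _ _
      _ ≤ ‖x‖ * (‖T ∘L S‖ * ‖x‖) := by gcongr; exact (T ∘L S).le_opNorm x
      _ = _ := by ring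
  · calc ‖T ∘L S‖ ≤ ‖T‖ * ‖S‖ := ContinuousLinearMap.opNorm_comp_le _ _
      _ ≤ ‖S‖ * ‖S‖ := by gcongr; exact h.norm_le
      _ = _ := (sq _).symm

theorem norm_eq (h : IsAdjointPair A S T) : ‖T‖ = ‖S‖ := le_antisymm h.norm_le h.symm.norm_le

end IsAdjointPair

theorem rankOne_apply (x : F) (y z : E) : rankOne A x y z = rsmul x (inner A y z) := rfl

theorem isAdjointPair_rankOne (x : F) (y : E) :
    IsAdjointPair A (rankOne A x y) (rankOne A y x) := fun z w => by
  rw [rankOne_apply, rankOne_apply, inner_rsmul_left', inner_rsmul, star_inner]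

theorem comp_rankOne {S : F →L[ℂ] G} {T : G →L[ℂ] F} (h : IsAdjointPair A S T) (x : F) (y : E) :
    S ∘L rankOne A x y = rankOne A (S x) y :=
  ContinuousLinearMap.ext fun z => by
    rw [ContinuousLinearMap.comp_apply, rankOne_apply, rankOne_apply, h.map_rsmul]

theorem rankOne_comp {S : E →L[ℂ] F} {T : F →L[ℂ] E} (h : IsAdjointPair A S T) (x : G) (y : F) :
    rankOne A x y ∘L S = rankOne A x (T y) :=
  ContinuousLinearMap.ext fun z => by
    rw [ContinuousLinearMap.comp_apply, rankOne_apply, rankOne_apply, h.symm]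

theorem isClosed_compacts : IsClosed (compacts A E F : Set (E →L[ℂ] F)) :=
  Submodule.isClosed_topologicalClosure _

theorem compacts_le {M : Submodule ℂ (E →L[ℂ] F)} (hM : IsClosed (M : Set (E →L[ℂ] F)))
    (h : ∀ x y, rankOne A x y ∈ M) : compacts A E F ≤ M := by
  refine Submodule.topologicalClosure_minimal _ (Submodule.span_le.mpr ?_) hM
  rintro _ ⟨x, y, rfl⟩
  exact h x y

/-- A closed linear condition that holds for rank one operators holds for compact operators. -/
theorem compacts_induction {p : compacts A E F → Prop}
    (hcl : IsClosed {T | p T}) (hadd : ∀ S T, p S → p T → p (S + T))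
    (hsmul : ∀ (c : ℂ) T, p T → p (c • T)) (h0 : p 0)
    (h : ∀ x y, p ⟨rankOne A x y, rankOne_mem_compacts x y⟩) (T : compacts A E F) : p T := by
  let N : Submodule ℂ (compacts A E F) :=
    { carrier := {T | p T}
      add_mem' := fun {S T} hS hT => hadd S T hS hT
      zero_mem' := h0
      smul_mem' := fun c T hT => hsmul c T hT }
  have hle : compacts A E F ≤ N.map (compacts A E F).subtype := by
    refine compacts_le ?_ fun x y => ⟨_, h x y, rfl⟩
    rw [Submodule.map_coe]
    exact isClosed_compacts.isClosedEmbedding_subtypeVal.isClosedMap _ hcl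
  obtain ⟨T', hT', he⟩ := hle T.2
  have : T' = T := Subtype.ext he
  exact this ▸ hT'

/-! ### Adjoints of compact operators and the C*-algebra of compact operators -/

variable [CompleteSpace E]

theorem exists_adjoint_mem_compacts {S : E →L[ℂ] F} (hS : S ∈ compacts A E F) :
    ∃ T ∈ compacts A F E, IsAdjointPair A S T := by
  let M : Submodule ℂ (E →L[ℂ] F) :=
    { carrier := {S | ∃ T ∈ compacts A F E, IsAdjointPair A S T}
      add_mem' := by
        rintro S S' ⟨T, hT, h⟩ ⟨T', hT', h'⟩
        exact ⟨T + T', add_mem hT hT', h.add h'⟩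
      zero_mem' := ⟨0, zero_mem _, IsAdjointPair.zero⟩
      smul_mem' := by
        rintro c S ⟨T, hT, h⟩
        exact ⟨star c • T, Submodule.smul_mem _ _ hT, h.smul c⟩ }
  refine compacts_le (M := M) ?_ (fun x y => ⟨_, rankOne_mem_compacts y x,
    isAdjointPair_rankOne x y⟩) hS
  refine isSeqClosed_iff_isClosed.mp fun u S hu hS => ?_
  choose v hv hv' using hu
  -- Passing to adjoints is isometric, so the adjoints of a convergent sequence are Cauchy. Their
  -- limit is the adjoint of the limit by continuity of the inner product.
  have hcauchy : CauchySeq v := by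
    have := hS.cauchySeq
    rw [Metric.cauchySeq_iff] at this ⊢
    intro ε hε
    obtain ⟨N, hN⟩ := this ε hε
    refine ⟨N, fun m hm n hn => ?_⟩
    rw [dist_eq_norm, ((hv' m).sub (hv' n)).norm_eq, ← dist_eq_norm]
    exact hN m hm n hn
  obtain ⟨T, hT⟩ := cauchySeq_tendsto_of_complete hcauchy
  refine ⟨T, isClosed_compacts.mem_of_tendsto hT (.of_forall hv), fun x y => ?_⟩
  have h1 : Filter.Tendsto (fun n => inner A (u n x) y) Filter.atTop (nhds (inner A (S x) y)) :=
    ((continuous_inner_left y).comp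
      (ContinuousLinearMap.apply ℂ F x).continuous).continuousAt.tendsto.comp hS
  have h2 : Filter.Tendsto (fun n => inner A x (v n y)) Filter.atTop (nhds (inner A x (T y))) :=
    ((continuous_inner_right x).comp
      (ContinuousLinearMap.apply ℂ E y).continuous).continuousAt.tendsto.comp hT
  refine tendsto_nhds_unique h1 (h2.congr fun n => ?_)
  exact ((hv' n) x y).symm

theorem comp_mem_compacts {S : F →L[ℂ] G} {T : E →L[ℂ] F} (hS : S ∈ compacts A F G)
    (hT : T ∈ compacts A E F) : S ∘L T ∈ compacts A E G := by
  obtain ⟨T', -, hT'⟩ := exists_adjoint_mem_compacts hT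
  refine compacts_le (A := A) (M := (compacts A E G).comap
    ((ContinuousLinearMap.compL ℂ E F G).flip T).toLinearMap)
    (isClosed_compacts.preimage ((ContinuousLinearMap.compL ℂ E F G).flip T).continuous)
    (fun x y => ?_) hS
  change rankOne A x y ∘L T ∈ compacts A E G
  rw [rankOne_comp hT']
  exact rankOne_mem_compacts _ _

/-- The adjoint of a compact operator. -/
noncomputable def compactsAdjoint (T : compacts A E F) : compacts A F E :=
  ⟨Classical.choose (exists_adjoint_mem_compacts T.2),
    (Classical.choose_spec (exists_adjoint_mem_compacts T.2)).1⟩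

theorem isAdjointPair_compactsAdjoint (T : compacts A E F) :
    IsAdjointPair A (T : E →L[ℂ] F) (compactsAdjoint T : F →L[ℂ] E) :=
  (Classical.choose_spec (exists_adjoint_mem_compacts T.2)).2

theorem compactsAdjoint_eq {T : compacts A E F} {T' : compacts A F E}
    (h : IsAdjointPair A (T : E →L[ℂ] F) (T' : F →L[ℂ] E)) : compactsAdjoint T = T' :=
  Subtype.ext ((isAdjointPair_compactsAdjoint T).unique h)

theorem compactsAdjoint_add (S T : compacts A E F) :
    compactsAdjoint (S + T) = compactsAdjoint S + compactsAdjoint T :=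
  compactsAdjoint_eq
    ((isAdjointPair_compactsAdjoint S).add (isAdjointPair_compactsAdjoint T))

theorem compactsAdjoint_smul (c : ℂ) (T : compacts A E F) :
    compactsAdjoint (c • T) = star c • compactsAdjoint T :=
  compactsAdjoint_eq ((isAdjointPair_compactsAdjoint T).smul c)

theorem compactsAdjoint_sub (S T : compacts A E F) :
    compactsAdjoint (S - T) = compactsAdjoint S - compactsAdjoint T :=
  compactsAdjoint_eq
    ((isAdjointPair_compactsAdjoint S).sub (isAdjointPair_compactsAdjoint T))

theorem compactsAdjoint_rankOne (x : F) (y : E) :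
    compactsAdjoint ⟨rankOne A x y, rankOne_mem_compacts x y⟩
      = ⟨rankOne A y x, rankOne_mem_compacts y x⟩ :=
  compactsAdjoint_eq (isAdjointPair_rankOne x y)

theorem isometry_compactsAdjoint :
    Isometry (compactsAdjoint : compacts A E F → compacts A F E) := by
  refine Isometry.of_dist_eq fun S T => ?_
  rw [dist_eq_norm, dist_eq_norm, ← compactsAdjoint_sub]
  exact (isAdjointPair_compactsAdjoint (S - T)).norm_eq

variable [CompleteSpace F]

theorem compactsAdjoint_compactsAdjoint (T : compacts A E F) :
    compactsAdjoint (compactsAdjoint T) = T :=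
  compactsAdjoint_eq (isAdjointPair_compactsAdjoint T).symm

/-- The composition of compact operators. -/
noncomputable def compactsComp (S : compacts A F G) (T : compacts A E F) : compacts A E G :=
  ⟨(S : F →L[ℂ] G) ∘L (T : E →L[ℂ] F), comp_mem_compacts S.2 T.2⟩

variable (A E) in
/-- The algebra of compact operators on `E`. -/
noncomputable def compactsAlgebra : NonUnitalSubalgebra ℂ (E →L[ℂ] E) where
  __ := compacts A E E
  mul_mem' hS hT := comp_mem_compacts hS hT

noncomputable instance : Star (compactsAlgebra A E) :=
  ⟨fun T => compactsAdjoint (A := A) (E := E) (F := E) T⟩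

theorem isAdjointPair_star (T : compactsAlgebra A E) :
    IsAdjointPair A (T : E →L[ℂ] E) (star T : compactsAlgebra A E) :=
  isAdjointPair_compactsAdjoint (A := A) (E := E) (F := E) T

/-- This makes functional calculus available for `T⋆T` with `T` compact, as the closedness of the
range of `Θ m n` requires. -/
noncomputable instance : NonUnitalCStarAlgebra (compactsAlgebra A E) where
  star_involutive T := compactsAdjoint_compactsAdjoint (A := A) (E := E) (F := E) T
  star_add S T := compactsAdjoint_add (A := A) (E := E) (F := E) S T
  star_mul S T := Subtype.ext ((isAdjointPair_star (S * T)).unique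
    ((isAdjointPair_star T).comp (isAdjointPair_star S)))
  star_smul c T := compactsAdjoint_smul (A := A) (E := E) (F := E) c T
  norm_smul_le c T := norm_smul_le c (T : E →L[ℂ] E)
  toCompleteSpace := (isClosed_compacts (A := A) (E := E) (F := E)).completeSpace_coe
  norm_mul_self_le T := by
    have h := (isAdjointPair_star T).norm_sq_eq
    rw [sq] at h
    exact h.le

end Adjoint

/-! ### Weak representations on the fibres and on compact operators -/

namespace WeakRepresentation

variable {A : Type*} [NonUnitalCStarAlgebra A] [PartialOrder A]
    [StarOrderedRing A] {E : ℕ → Type*} [∀ n, NormedAddCommGroup (E n)]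
    [∀ n, NormedSpace ℂ (E n)] [∀ n, CompleteSpace (E n)] [∀ n, Correspondence A (E n)]
    {P : WeakPartialProductSystem A E} {B : Type*} [NonUnitalCStarAlgebra B]
    (ω : WeakRepresentation P B)

theorem map_mul_map' {n m k : ℕ} (h : n + m = k) (x : E n) (y : E m) :
    ω.map n x * ω.map m y = ω.map k (P.mul h x y) := by
  subst h
  exact ω.map_mul_map n m x y

theorem map_zero_unit_mul (a b : A) :
    ω.map 0 (P.unit a) * ω.map 0 (P.unit b) = ω.map 0 (P.unit (a * b)) := by
  rw [ω.map_mul_map' (zero_add 0), P.unit_mul, P.lsmul_unit]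

theorem star_map_zero_unit_mul (a b : A) :
    star (ω.map 0 (P.unit a)) * ω.map 0 (P.unit b) = ω.map 0 (P.unit (star a * b)) := by
  rw [ω.star_map_mul_map, P.inner_unit]

/-- The axioms do not ask `ω 0` to preserve adjoints. They do give `ω 0 (c⋆c) = (ω 0 c)⋆ ω 0 c`,
which is self-adjoint, and positive elements span `A`. -/
theorem star_map_zero_unit (a : A) :
    star (ω.map 0 (P.unit a)) = ω.map 0 (P.unit (star a)) := by
  have hpos : ∀ b : A, 0 ≤ b → star (ω.map 0 (P.unit b)) = ω.map 0 (P.unit b) := by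
    intro b hb
    rw [StarOrderedRing.nonneg_iff] at hb
    induction hb using AddSubmonoid.closure_induction with
    | mem x hx =>
      obtain ⟨c, rfl⟩ := hx
      change star (ω.map 0 (P.unit (star c * c))) = ω.map 0 (P.unit (star c * c))
      rw [← ω.star_map_zero_unit_mul, star_mul, star_star]
    | zero => simp
    | add x y _ _ hx hy => simp only [map_add, star_add, hx, hy]
  have ha : a ∈ Submodule.span ℂ {b : A | 0 ≤ b} := by
    rw [CStarAlgebra.span_nonneg]; trivial
  induction ha using Submodule.span_induction with
  | mem b hb => rw [hpos b hb, (IsSelfAdjoint.of_nonneg hb).star_eq]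
  | zero => simp
  | add x y _ _ hx hy => simp only [map_add, star_add, hx, hy]
  | smul c x _ hx => simp only [map_smul, star_smul, hx]

/-- The `*`-homomorphism `A → B` given by `ω 0`. -/
noncomputable def hom : A →⋆ₙₐ[ℂ] B where
  toFun a := ω.map 0 (P.unit a)
  map_smul' c a := by simp
  map_zero' := by simp
  map_add' a b := by simp
  map_mul' a b := (ω.map_zero_unit_mul a b).symm
  map_star' a := (ω.star_map_zero_unit a).symm

theorem map_zero_eq_hom (x : E 0) : ω.map 0 x = ω.hom (P.unit.symm x) := by
  change _ = ω.map 0 (P.unit (P.unit.symm x))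
  rw [LinearEquiv.apply_symm_apply]

theorem star_map_mul_map_eq_hom {n : ℕ} (x y : E n) :
    star (ω.map n x) * ω.map n y = ω.hom (inner A x y) :=
  ω.star_map_mul_map n x y

theorem map_mul_hom {n : ℕ} (x : E n) (a : A) :
    ω.map n x * ω.hom a = ω.map n (HilbertModule.rsmul x a) := by
  rw [← P.mul_unit, ← ω.map_mul_map' (add_zero n)]
  rfl

theorem hom_mul_map {n : ℕ} (a : A) (x : E n) :
    ω.hom a * ω.map n x = ω.map n (Correspondence.lsmul a x) := by
  rw [← P.unit_mul, ← ω.map_mul_map' (zero_add n)]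
  rfl

theorem norm_map_le {n : ℕ} (x : E n) : ‖ω.map n x‖ ≤ ‖x‖ := by
  rw [← pow_le_pow_iff_left₀ (norm_nonneg _) (norm_nonneg _) two_ne_zero, sq,
    ← CStarRing.norm_star_mul_self, ω.star_map_mul_map_eq_hom, HilbertModule.norm_sq_eq (A := A)]
  exact NonUnitalStarAlgHom.norm_apply_le ω.hom _

/-- The bounded linear map `ω n`. -/
noncomputable def mapL (n : ℕ) : E n →L[ℂ] B :=
  (ω.map n).mkContinuous 1 fun x => by rw [one_mul]; exact ω.norm_map_le x

theorem isClosed_img (n : ℕ) : IsClosed (ω.img n) :=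
  isClosed_range_of_quadratic ω.hom (ω.mapL n) (q := fun x => inner A x x)
    (act := HilbertModule.rsmul) inner_isSelfAdjoint HilbertModule.norm_sq_eq
    (fun x _ hd => inner_sub_rsmul x hd) (fun x d => (ω.map_mul_hom x d).symm)
    (fun x => ω.star_map_mul_map_eq_hom x x)

/-- Every `ω n x` is a limit of elements `ω n x ω 0 a`. -/
theorem map_mem_of_map_mul_hom_mem {n : ℕ} {x : E n} {s : Set B} (hs : IsClosed s)
    (h : ∀ a, ω.map n x * ω.hom a ∈ s) : ω.map n x ∈ s := by
  rw [← hs.closure_eq, Metric.mem_closure_iff]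
  intro ε hε
  obtain ⟨a, ha⟩ := exists_norm_sub_act_le (q := fun x : E n => inner A x x)
    (act := HilbertModule.rsmul) inner_isSelfAdjoint HilbertModule.norm_sq_eq
    (fun x _ hd => inner_sub_rsmul x hd) x (half_pos hε)
  refine ⟨_, h a, ?_⟩
  rw [dist_eq_norm, map_mul_hom, ← map_sub]
  exact ((ω.norm_map_le _).trans ha).trans_lt (half_lt_self hε)

/-! ### Construction of the maps `Θ` -/

/-- The span of the pairs `(|x⟩⟨y|, ω n x (ω m y)⋆)`. -/
noncomputable def thetaGraph (m n : ℕ) : Submodule ℂ ((E m →L[ℂ] E n) × B) :=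
  Submodule.span ℂ {p | ∃ x y, p = (rankOne A x y, ω.map n x * star (ω.map m y))}

/-- The span of the elements `ω n x (ω m y)⋆`. -/
noncomputable def mulStarSpan (m n : ℕ) : Submodule ℂ B :=
  Submodule.span ℂ {b | ∃ x y, b = ω.map n x * star (ω.map m y)}

/-- On the images of the fibres `b` acts as `T` and `b⋆` as `T⋆`. These relations are linear in the
pair, so rank one operators suffice. -/
theorem thetaGraph_spec {m n : ℕ} {p : (E m →L[ℂ] E n) × B} (hp : p ∈ ω.thetaGraph m n) :
    (∀ z, p.2 * ω.map m z = ω.map n (p.1 z)) ∧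
    (∃ T', IsAdjointPair A p.1 T' ∧ ∀ w, star p.2 * ω.map n w = ω.map m (T' w)) ∧
    p.2 ∈ ω.mulStarSpan m n := by
  induction hp using Submodule.span_induction with
  | mem p hp =>
    obtain ⟨x, y, rfl⟩ := hp
    refine ⟨fun z => ?_, ⟨rankOne A y x, isAdjointPair_rankOne x y, fun w => ?_⟩,
      Submodule.subset_span ⟨x, y, rfl⟩⟩
    · rw [mul_assoc, star_map_mul_map_eq_hom, map_mul_hom, rankOne_apply]
    · rw [star_mul, star_star, mul_assoc, star_map_mul_map_eq_hom, map_mul_hom, rankOne_apply]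
  | zero => exact ⟨by simp, ⟨0, .zero, by simp⟩, zero_mem _⟩
  | add p q _ _ hp hq =>
    obtain ⟨h1, ⟨T, h2, h3⟩, h4⟩ := hp
    obtain ⟨h1', ⟨T', h2', h3'⟩, h4'⟩ := hq
    exact ⟨fun z => by simp [add_mul, h1, h1'],
      ⟨T + T', h2.add h2', fun w => by simp [add_mul, h3, h3']⟩, add_mem h4 h4'⟩
  | smul c p _ hp =>
    obtain ⟨h1, ⟨T, h2, h3⟩, h4⟩ := hp
    exact ⟨fun z => by simp [smul_mul_assoc, h1],
      ⟨star c • T, h2.smul c, fun w => by simp [smul_mul_assoc, h3]⟩,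
      Submodule.smul_mem _ _ h4⟩

/-- Each multiplication by `a` replaces the left vector in `ω m x (ω m y)⋆` by its image under `U`.
The constant depends on how `c` is written as a sum, which is harmless once roots are taken. -/
theorem norm_iterate_mul_le {m : ℕ} {a : B} {U : E m →L[ℂ] E m}
    (ha : ∀ z, a * ω.map m z = ω.map m (U z)) {c : B} (hc : c ∈ ω.mulStarSpan m m) :
    ∃ C : ℝ, ∀ k : ℕ, ‖(fun c => a * c)^[k] c‖ ≤ C * ‖U‖ ^ k := by
  have hadd : ∀ (k : ℕ) (c d : B), (fun c => a * c)^[k] (c + d)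
      = (fun c => a * c)^[k] c + (fun c => a * c)^[k] d := fun k c d =>
    iterate_map_add (AddMonoidHom.mulLeft a) k c d
  induction hc using Submodule.span_induction with
  | mem c hc =>
    obtain ⟨x, y, rfl⟩ := hc
    refine ⟨‖x‖ * ‖y‖, fun k => ?_⟩
    have h1 : (fun c => a * c)^[k] (ω.map m x * star (ω.map m y))
        = ω.map m ((U ^ k) x) * star (ω.map m y) := by
      induction k with
      | zero => simp
      | succ k ih => rw [Function.iterate_succ_apply', ih, ← mul_assoc, ha, pow_succ']; rfl
    have hpow : ∀ k : ℕ, ‖(U ^ k) x‖ ≤ ‖U‖ ^ k * ‖x‖ := fun k => by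
      induction k with
      | zero => simp
      | succ k ih =>
        rw [pow_succ', pow_succ', mul_assoc]
        exact (U.le_opNorm _).trans (mul_le_mul_of_nonneg_left ih (norm_nonneg U))
    rw [h1]
    calc _ ≤ ‖ω.map m ((U ^ k) x)‖ * ‖star (ω.map m y)‖ := norm_mul_le _ _
      _ ≤ (‖U‖ ^ k * ‖x‖) * ‖y‖ := by
        rw [norm_star]
        gcongr
        · exact (ω.norm_map_le _).trans (hpow k)
        · exact ω.norm_map_le y
      _ = _ := by ring
  | zero =>
    refine ⟨0, fun k => ?_⟩
    have h1 : (fun c => a * c)^[k] 0 = 0 := Function.iterate_fixed (mul_zero a) k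
    rw [h1]; simp
  | add c d _ _ hc hd =>
    obtain ⟨C, hC⟩ := hc
    obtain ⟨C', hC'⟩ := hd
    refine ⟨C + C', fun k => ?_⟩
    rw [hadd, add_mul]
    exact (norm_add_le _ _).trans (add_le_add (hC k) (hC' k))
  | smul z c _ hc =>
    obtain ⟨C, hC⟩ := hc
    refine ⟨‖z‖ * C, fun k => ?_⟩
    have h1 : (fun c => a * c)^[k] (z • c) = z • (fun c => a * c)^[k] c := by
      induction k with
      | zero => rfl
      | succ k ih => rw [Function.iterate_succ_apply', ih, Function.iterate_succ_apply',
          mul_smul_comm]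
    rw [h1, norm_smul, mul_assoc]
    gcongr
    exact hC k

/-- The growth estimate is applied with `b⋆b` both as the multiplier and as the starting element,
and with `U = T⋆T`. In particular `T = 0` forces `b = 0`, so `Θ` is well defined. -/
theorem norm_le_of_mem_thetaGraph {m n : ℕ} {p : (E m →L[ℂ] E n) × B}
    (hp : p ∈ ω.thetaGraph m n) : ‖p.2‖ ≤ ‖p.1‖ := by
  obtain ⟨h1, ⟨T', h2, h3⟩, h4⟩ := ω.thetaGraph_spec hp
  have hU : ∀ z, (star p.2 * p.2) * ω.map m z = ω.map m ((T' ∘L p.1) z) := fun z => by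
    rw [mul_assoc, h1, h3]; rfl
  have hmem : star p.2 * p.2 ∈ ω.mulStarSpan m m := by
    have hle : ω.mulStarSpan m n ≤
        (ω.mulStarSpan m m).comap (LinearMap.mulLeft ℂ (star p.2)) := by
      refine Submodule.span_le.mpr ?_
      rintro _ ⟨x, y, rfl⟩
      change star p.2 * (ω.map n x * star (ω.map m y)) ∈ ω.mulStarSpan m m
      rw [← mul_assoc, h3]
      exact Submodule.subset_span ⟨_, y, rfl⟩
    exact hle h4
  obtain ⟨C, hC⟩ := ω.norm_iterate_mul_le hU hmem
  have h5 := norm_le_of_iterate_mul_le (IsSelfAdjoint.star_mul_self p.2) (norm_nonneg _) hC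
  rw [CStarRing.norm_star_mul_self, ← sq, ← h2.norm_sq_eq] at h5
  exact (pow_le_pow_iff_left₀ (norm_nonneg _) (norm_nonneg _) two_ne_zero).mp h5

theorem norm_le_of_mem_closure_thetaGraph {m n : ℕ} {p : (E m →L[ℂ] E n) × B}
    (hp : p ∈ (ω.thetaGraph m n).topologicalClosure) : ‖p.2‖ ≤ ‖p.1‖ :=
  closure_minimal (s := (ω.thetaGraph m n : Set _)) 
    (t := {p : (E m →L[ℂ] E n) × B | ‖p.2‖ ≤ ‖p.1‖})
    (fun _ => ω.norm_le_of_mem_thetaGraph) (isClosed_le (by fun_prop) (by fun_prop))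
    (show p ∈ closure (ω.thetaGraph m n : Set ((E m →L[ℂ] E n) × B)) from hp)

/-- By the norm bound, the projection to the first coordinate is isometric on the closed graph for
the maximum norm. Its range is therefore complete, hence closed, and it contains the rank one
operators. -/
theorem exists_mem_closure_thetaGraph {m n : ℕ} (T : compacts A (E m) (E n)) :
    ∃ b, ((T : E m →L[ℂ] E n), b) ∈ (ω.thetaGraph m n).topologicalClosure := by
  set M := (ω.thetaGraph m n).topologicalClosure with hM
  have hMc : IsClosed (M : Set ((E m →L[ℂ] E n) × B)) := Submodule.isClosed_topologicalClosure _
  have : CompleteSpace M := hMc.completeSpace_coe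
  let f : M →ₗᵢ[ℂ] (E m →L[ℂ] E n) :=
    { toLinearMap := (LinearMap.fst ℂ _ _).comp M.subtype
      norm_map' := fun p => (max_eq_left (ω.norm_le_of_mem_closure_thetaGraph p.2)).symm }
  have hle : compacts A (E m) (E n) ≤ LinearMap.range f.toLinearMap := by
    refine compacts_le ?_ fun x y => ?_
    · exact f.isometry.isClosedEmbedding.isClosed_range
    · exact ⟨⟨_, Submodule.le_topologicalClosure _ (Submodule.subset_span ⟨x, y, rfl⟩)⟩, rfl⟩
  obtain ⟨p, hp⟩ := hle T.2
  refine ⟨p.1.2, ?_⟩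
  rw [← hp]
  exact p.2

theorem closure_thetaGraph_unique {m n : ℕ} {T : E m →L[ℂ] E n} {b b' : B}
    (h : (T, b) ∈ (ω.thetaGraph m n).topologicalClosure)
    (h' : (T, b') ∈ (ω.thetaGraph m n).topologicalClosure) : b = b' := by
  have := ω.norm_le_of_mem_closure_thetaGraph (sub_mem h h')
  simpa [sub_eq_zero] using this

/-- The map `Θ m n : 𝕂(E m, E n) → B`. -/
noncomputable def theta (m n : ℕ) : compacts A (E m) (E n) →L[ℂ] B :=
  LinearMap.mkContinuous
    { toFun := fun T => Classical.choose (ω.exists_mem_closure_thetaGraph T)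
      map_add' := fun S T => ω.closure_thetaGraph_unique
        (Classical.choose_spec (ω.exists_mem_closure_thetaGraph (S + T)))
        (add_mem (Classical.choose_spec (ω.exists_mem_closure_thetaGraph S))
          (Classical.choose_spec (ω.exists_mem_closure_thetaGraph T)))
      map_smul' := fun c T => ω.closure_thetaGraph_unique
        (Classical.choose_spec (ω.exists_mem_closure_thetaGraph (c • T)))
        (Submodule.smul_mem _ c (Classical.choose_spec (ω.exists_mem_closure_thetaGraph T))) }
    1 fun T => by
      rw [one_mul]
      exact ω.norm_le_of_mem_closure_thetaGraph
        (Classical.choose_spec (ω.exists_mem_closure_thetaGraph T))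

theorem isTheta_theta : ω.IsTheta ω.theta := fun m n x y =>
  ω.closure_thetaGraph_unique
    (Classical.choose_spec (ω.exists_mem_closure_thetaGraph
      (⟨rankOne A x y, rankOne_mem_compacts x y⟩ : compacts A (E m) (E n))))
    (Submodule.le_topologicalClosure _ (Submodule.subset_span ⟨x, y, rfl⟩))

theorem isTheta_unique {Θ : ∀ m n : ℕ, compacts A (E m) (E n) →L[ℂ] B} (hΘ : ω.IsTheta Θ) :
    Θ = ω.theta := by
  funext m n
  refine ContinuousLinearMap.ext fun T => ?_
  refine compacts_induction (p := fun T => Θ m n T = ω.theta m n T)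
    (isClosed_eq (Θ m n).continuous (ω.theta m n).continuous) ?_ ?_ ?_ ?_ T
  · intro S T hS hT; rw [map_add, map_add, hS, hT]
  · intro c T hT; rw [map_smul, map_smul, hT]
  · rw [map_zero, map_zero]
  · intro x y; rw [hΘ, ω.isTheta_theta]

/-! ### Products, adjoints and closed range of `Θ` -/

theorem theta_mul_map {m n : ℕ} (T : compacts A (E m) (E n)) (z : E m) :
    ω.theta m n T * ω.map m z = ω.map n ((T : E m →L[ℂ] E n) z) := by
  refine compacts_induction
    (p := fun T => ω.theta m n T * ω.map m z = ω.map n ((T : E m →L[ℂ] E n) z))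
    (isClosed_eq ((ω.theta m n).continuous.mul continuous_const)
      ((ω.mapL n).continuous.comp
        ((ContinuousLinearMap.apply ℂ (E n) z).continuous.comp continuous_subtype_val)))
    ?_ ?_ ?_ ?_ T
  · intro S T hS hT
    rw [map_add, add_mul, hS, hT, ← map_add]; rfl
  · intro c T hT
    rw [map_smul, smul_mul_assoc, hT, ← map_smul]; rfl
  · rw [map_zero, zero_mul]; exact (map_zero _).symm
  · intro x y
    rw [ω.isTheta_theta, mul_assoc, star_map_mul_map_eq_hom, map_mul_hom]; rfl

theorem theta_mul_theta {m n k : ℕ} (S : compacts A (E n) (E k)) (T : compacts A (E m) (E n)) :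
    ω.theta n k S * ω.theta m n T = ω.theta m k (compactsComp S T) := by
  refine compacts_induction
    (p := fun T => ω.theta n k S * ω.theta m n T = ω.theta m k (compactsComp S T))
    (isClosed_eq (continuous_const.mul (ω.theta m n).continuous)
      ((ω.theta m k).continuous.comp (Continuous.subtype_mk
        ((ContinuousLinearMap.compL ℂ (E m) (E n) (E k) S).continuous.comp
          continuous_subtype_val) _)))
    ?_ ?_ ?_ ?_ T
  · intro T T' h h'
    rw [map_add, mul_add, h, h', ← map_add]
    congr 1
    exact Subtype.ext (ContinuousLinearMap.comp_add _ _ _).symm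
  · intro c T h
    rw [map_smul, mul_smul_comm, h, ← map_smul]
    congr 1
    exact Subtype.ext (ContinuousLinearMap.comp_smul _ _ _).symm
  · rw [map_zero, mul_zero, ← map_zero (ω.theta m k)]
    congr 1
    exact Subtype.ext (ContinuousLinearMap.comp_zero _).symm
  · intro x y
    rw [ω.isTheta_theta, ← mul_assoc, theta_mul_map, ← ω.isTheta_theta]
    congr 1
    exact Subtype.ext (comp_rankOne (isAdjointPair_compactsAdjoint S) x y).symm

theorem star_theta {m n : ℕ} (T : compacts A (E m) (E n)) :
    star (ω.theta m n T) = ω.theta n m (compactsAdjoint T) := by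
  refine compacts_induction
    (p := fun T => star (ω.theta m n T) = ω.theta n m (compactsAdjoint T))
    (isClosed_eq (continuous_star.comp (ω.theta m n).continuous)
      ((ω.theta n m).continuous.comp isometry_compactsAdjoint.continuous)) ?_ ?_ ?_ ?_ T
  · intro S T hS hT
    rw [map_add, star_add, hS, hT, compactsAdjoint_add, map_add]
  · intro c T hT
    rw [map_smul, star_smul, hT, compactsAdjoint_smul, map_smul]
  · rw [map_zero, star_zero, compactsAdjoint_eq (T' := 0) IsAdjointPair.zero, map_zero]
  · intro x y
    rw [ω.isTheta_theta, compactsAdjoint_rankOne, ω.isTheta_theta, star_mul, star_star]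

/-- The `*`-homomorphism `Θ m m` on the C*-algebra of compact operators. -/
noncomputable def thetaHom (m : ℕ) : compactsAlgebra A (E m) →⋆ₙₐ[ℂ] B where
  toFun T := ω.theta m m T
  map_smul' c T := map_smul (ω.theta m m) c T
  map_zero' := map_zero (ω.theta m m)
  map_add' S T := map_add (ω.theta m m) S T
  map_mul' S T := (ω.theta_mul_theta S T).symm
  map_star' T := (ω.star_theta T).symm

/-- `𝕂(E m, E n)` is a right Hilbert module over the C*-algebra `𝕂(E m, E m)` with inner product
`S⋆T`, and `Θ m n` is a module map along the `*`-homomorphism `Θ m m`. -/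
theorem isClosed_range_theta (m n : ℕ) : IsClosed (Set.range (ω.theta m n)) := by
  have : CompleteSpace (compacts A (E m) (E n)) := isClosed_compacts.completeSpace_coe
  have hstar : ∀ T : compacts A (E m) (E n),
      star (show compactsAlgebra A (E m) from compactsComp (compactsAdjoint T) T)
        = compactsComp (compactsAdjoint T) T := fun T =>
    compactsAdjoint_eq ((isAdjointPair_compactsAdjoint T).comp
      (isAdjointPair_compactsAdjoint T).symm)
  refine isClosed_range_of_quadratic (V := compacts A (E m) (E n)) (ω.thetaHom m) (ω.theta m n)
    (q := fun T => compactsComp (compactsAdjoint T) T)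
    (act := fun T d => compactsComp T (show compacts A (E m) (E m) from d)) ?_ ?_ ?_ ?_ ?_
  · exact hstar
  · exact fun T => (isAdjointPair_compactsAdjoint T).norm_sq_eq
  · intro T d hd
    have h1 : compactsAdjoint (T - compactsComp T (show compacts A (E m) (E m) from d))
        = compactsAdjoint T - compactsComp (show compacts A (E m) (E m) from d)
          (compactsAdjoint T) := by
      have h2 := isAdjointPair_star d
      rw [hd.star_eq] at h2
      exact compactsAdjoint_eq ((isAdjointPair_compactsAdjoint T).sub
        (h2.comp (isAdjointPair_compactsAdjoint T)))
    refine Subtype.ext (ContinuousLinearMap.ext fun z => ?_)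
    set T' : E n →L[ℂ] E m := (compactsAdjoint T : compacts A (E n) (E m)).1 with hT'
    set S : E m →L[ℂ] E n := T.1 with hS
    set D : E m →L[ℂ] E m := d.1 with hD
    simp only [h1]
    change T' (S z - S (D z)) - D (T' (S z - S (D z)))
      = T' (S z) - D (T' (S z)) - T' (S (D z)) + D (T' (S (D z)))
    simp only [map_sub]
    abel
  · exact fun T d => (ω.theta_mul_theta T _).symm
  · intro T
    rw [star_theta, theta_mul_theta]
    rfl

theorem range_theta_subset {m n : ℕ} (M : Submodule ℂ B) (hM : IsClosed (M : Set B))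
    (h : ∀ x y, ω.map n x * star (ω.map m y) ∈ M) : Set.range (ω.theta m n) ⊆ M := by
  rintro _ ⟨T, rfl⟩
  refine compacts_induction (p := fun T => ω.theta m n T ∈ M)
    (hM.preimage (ω.theta m n).continuous) ?_ ?_ ?_ ?_ T
  · intro S T hS hT; rw [map_add]; exact add_mem hS hT
  · intro c T hT; rw [map_smul]; exact Submodule.smul_mem _ _ hT
  · rw [map_zero]; exact zero_mem _
  · intro x y; rw [ω.isTheta_theta]; exact h x y

end WeakRepresentation

/-! ### Annihilation as the adjoint of multiplication between fibres -/

namespace WeakPartialProductSystem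

variable {A : Type*} [NonUnitalCStarAlgebra A] [PartialOrder A]
    [StarOrderedRing A] {E : ℕ → Type*} [∀ n, NormedAddCommGroup (E n)]
    [∀ n, NormedSpace ℂ (E n)] [∀ n, CompleteSpace (E n)] [∀ n, Correspondence A (E n)]

/-- The adjoint relation on the Fock module, tested on vectors of single summands. It is the only
property of `(S n x)⋆ y` that the equivalence needs. -/
theorem inner_annihilate {P : WeakPartialProductSystem A E} (hP : P.FockExists) {n m : ℕ}
    (hnm : n ≤ m) (x : E n) (y : E m) (w : E (m - n)) :
    inner A w (P.annihilate hP x y) = inner A (P.mul (Nat.add_sub_of_le hnm) x w) y := by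
  have h := inner_creation hP n x (fockOf (m - n) w) (fockOf m y)
  rw [fockOf_inner, inner_fockOf] at h
  rw [annihilate, ← h]
  congr 1
  simp [creation, fockOf, hnm]

end WeakPartialProductSystem

/-! ### The equivalent conditions -/

namespace WeakRepresentation

variable {A : Type*} [NonUnitalCStarAlgebra A] [PartialOrder A]
    [StarOrderedRing A] {E : ℕ → Type*} [∀ n, NormedAddCommGroup (E n)]
    [∀ n, NormedSpace ℂ (E n)] [∀ n, CompleteSpace (E n)] [∀ n, Correspondence A (E n)]
    {P : WeakPartialProductSystem A E} {B : Type*} [NonUnitalCStarAlgebra B]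
    (ω : WeakRepresentation P B)

theorem map_mem_img {n : ℕ} (x : E n) : ω.map n x ∈ ω.img n := ⟨x, rfl⟩

theorem star_map_mem_imgStar {n : ℕ} (x : E n) : star (ω.map n x) ∈ ω.imgStar n := ⟨x, rfl⟩

theorem star_mem_imgStar {n : ℕ} : ∀ b ∈ ω.img n, star b ∈ ω.imgStar n := by
  rintro _ ⟨x, rfl⟩
  exact ⟨x, rfl⟩

theorem star_mem_img {n : ℕ} : ∀ b ∈ ω.imgStar n, star b ∈ ω.img n := by
  rintro _ ⟨x, rfl⟩
  exact ⟨x, (star_star _).symm⟩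

theorem star_map_zero (a : E 0) : ∃ b, star (ω.map 0 a) = ω.hom b :=
  ⟨star (P.unit.symm a), by rw [map_zero_eq_hom, map_star]⟩

theorem closedMul_subset_img {n m k : ℕ}
    (h : ∀ (x : E n) (y : E m), star (ω.map n x) * ω.map m y ∈ ω.img k) :
    closedMul (ω.imgStar n) (ω.img m) ⊆ ω.img k := by
  refine closedMul_subset (LinearMap.range (ω.map k)) (ω.isClosed_img k) ?_
  rintro _ ⟨x, rfl⟩ _ ⟨y, rfl⟩
  exact h x y

/-- Left multiplication by `ω 0 (E 0)⋆` is the left action of `A`, so the case `n = 0` is automatic.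
It has to be supplied wherever a condition assumes `1 ≤ n`. -/
theorem closedMul_imgStar_zero_subset (m : ℕ) :
    closedMul (ω.imgStar 0) (ω.img m) ⊆ ω.img m :=
  ω.closedMul_subset_img fun x y => by
    obtain ⟨b, hb⟩ := ω.star_map_zero x
    rw [hb, hom_mul_map]
    exact ω.map_mem_img _

theorem closedMul_closedMul_univ_subset {n m k : ℕ}
    (h : closedMul (ω.imgStar n) (ω.img m) ⊆ closedMul (ω.img k) Set.univ) :
    closedMul (closedMul (ω.imgStar n) (ω.img m)) Set.univ ⊆ closedMul (ω.img k) Set.univ :=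
  closedMul_subset_closedMul fun _ hc _ _ =>
    mul_right_mem_closedMul (fun _ _ => Set.mem_univ _) (h hc)

/-- If `star (ω n x) * ω m y * b` lies in `ω (m - n) (E (m - n)) · B` for all `b`, then
`star (ω n x) * ω m y` is the image of `(S n x)⋆ y`. -/
theorem star_map_mul_map_eq_annihilate (hP : P.FockExists) {n m : ℕ} (hnm : n ≤ m)
    {x : E n} {y : E m}
    (h : ∀ b, star (ω.map n x) * ω.map m y * b ∈ closedMul (ω.img (m - n)) Set.univ) :
    star (ω.map n x) * ω.map m y = ω.map (m - n) (P.annihilate hP x y) := by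
  set d := star (ω.map n x) * ω.map m y - ω.map (m - n) (P.annihilate hP x y) with hd
  -- Since `ω n x * ω (m - n) w = ω m (x w)`, both terms of `(ω (m - n) w)⋆ d` are `ω 0` of inner
  -- products, and these agree by adjointness.
  have horth : ∀ w : E (m - n), star d * ω.map (m - n) w = 0 := by
    intro w
    rw [← star_star (ω.map (m - n) w), ← star_mul, star_eq_zero, hd, mul_sub, ← mul_assoc,
      ← star_mul, ω.map_mul_map' (Nat.add_sub_of_le hnm), star_map_mul_map_eq_hom,
      star_map_mul_map_eq_hom, P.inner_annihilate hP hnm, sub_self]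
  have hker : ∀ c ∈ closedMul (ω.img (m - n)) Set.univ, star d * c = 0 := by
    refine closedMul_subset (LinearMap.ker (LinearMap.mulLeft ℂ (star d)))
      (isClosed_eq (continuous_const_mul (star d)) continuous_const) ?_
    rintro _ ⟨w, rfl⟩ b -
    change star d * (ω.map (m - n) w * b) = 0
    rw [← mul_assoc, horth, zero_mul]
  have hdb : ∀ b, d * b ∈ closedMul (ω.img (m - n)) Set.univ := fun b => by
    rw [hd, sub_mul]
    exact sub_mem (S := Submodule ℂ B) (H := closedMulSubmodule (ω.img (m - n)) Set.univ) (h b)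
      (mul_mem_closedMul (ω.map_mem_img _) (Set.mem_univ b))
  -- Choosing `b = d⋆d` gives `(d⋆d)⋆(d⋆d) = 0`, and the C*-identity applied twice gives `d = 0`
  -- without a unit in `B`.
  have h1 := hker _ (hdb (star d * d))
  have h2 : star (star d * d) * (star d * d) = 0 := by
    rw [star_mul, star_star, mul_assoc, h1]
  rw [CStarRing.star_mul_self_eq_zero_iff, CStarRing.star_mul_self_eq_zero_iff] at h2
  exact sub_eq_zero.mp h2

theorem closedMul_range_theta_subset {m n p q : ℕ} (M : Submodule ℂ B)
    (hM : IsClosed (M : Set B))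
    (h : ∀ (x : E n) (y : E m) (z : E q) (w : E p),
      ω.map n x * star (ω.map m y) * (ω.map q z * star (ω.map p w)) ∈ M) :
    closedMul (Set.range (ω.theta m n)) (Set.range (ω.theta p q)) ⊆ M := by
  refine closedMul_subset M hM fun S hS T hT => ?_
  refine ω.range_theta_subset (M.comap (LinearMap.mulRight ℂ T))
    (hM.preimage (continuous_mul_const T)) (fun x y => ?_) hS
  exact ω.range_theta_subset (M.comap (LinearMap.mulLeft ℂ (ω.map n x * star (ω.map m y))))
    (hM.preimage (continuous_const_mul _)) (fun z w => h x y z w) hT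

theorem range_theta_zero_subset (n : ℕ) : Set.range (ω.theta 0 n) ⊆ ω.img n := by
  refine ω.range_theta_subset (LinearMap.range (ω.map n)) (ω.isClosed_img n) fun x y => ?_
  obtain ⟨b, hb⟩ := ω.star_map_zero y
  rw [hb, map_mul_hom]
  exact ω.map_mem_img _

/-- The ranges of `Θ n 0` and `Θ 0 m` contain only products of `(ω n x)⋆` and `ω m y` with elements
of `ω 0 (E 0)`. These outer factors are removed by approximating `x` and `y` by `x b` and `y a`,
because the image of `ω (m - n)` is closed. -/
theorem star_map_mul_map_mem_img {n m : ℕ}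
    (h : closedMul (Set.range (ω.theta n 0)) (Set.range (ω.theta 0 m)) ⊆
      Set.range (ω.theta 0 (m - n))) (x : E n) (y : E m) :
    star (ω.map n x) * ω.map m y ∈ ω.img (m - n) := by
  refine ω.map_mem_of_map_mul_hom_mem (x := y)
    ((ω.isClosed_img (m - n)).preimage (continuous_const_mul (star (ω.map n x)))) fun a => ?_
  refine ω.map_mem_of_map_mul_hom_mem (x := x)
    (s := {c | star c * (ω.map m y * ω.hom a) ∈ ω.img (m - n)})
    ((ω.isClosed_img (m - n)).preimage (continuous_star.mul_const _)) fun b => ?_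
  refine ω.range_theta_zero_subset _ (h ?_)
  have h1 : star (ω.map n x * ω.hom b) = ω.map 0 (P.unit (star b)) * star (ω.map n x) := by
    rw [star_mul, ← map_star]; rfl
  have h2 : ω.map m y * ω.hom a = ω.map m y * star (ω.map 0 (P.unit (star a))) := by
    rw [star_map_zero_unit, star_star]; rfl
  rw [h1, h2, ← ω.isTheta_theta, ← ω.isTheta_theta]
  exact mul_mem_closedMul ⟨_, rfl⟩ ⟨_, rfl⟩

/-- The condition on `Θ` ranges over all indices, so the boundary cases are needed too: for `n = m`
the product is `ω 0` of an inner product, and for `n = 0` it is a left action. -/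
theorem star_map_mul_map_mem_img_of_le
    (h : ∀ n m : ℕ, 1 ≤ n → 1 ≤ m → n < m → closedMul (ω.imgStar n) (ω.img m) ⊆ ω.img (m - n))
    {n m : ℕ} (hnm : n ≤ m) (x : E n) (y : E m) :
    star (ω.map n x) * ω.map m y ∈ ω.img (m - n) := by
  rcases hnm.eq_or_lt with rfl | hlt
  · rw [Nat.sub_self, star_map_mul_map_eq_hom]
    exact ⟨_, rfl⟩
  rcases Nat.eq_zero_or_pos n with rfl | hn
  · exact ω.closedMul_imgStar_zero_subset m
      (mul_mem_closedMul (ω.star_map_mem_imgStar x) (ω.map_mem_img y))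
  · exact h n m hn (hn.trans hlt) hlt
      (mul_mem_closedMul (ω.star_map_mem_imgStar x) (ω.map_mem_img y))

theorem tfae_conditions (hP : P.FockExists) :
    List.TFAE [
      ∀ n m : ℕ, 1 ≤ n → 1 ≤ m → n < m → ∀ (x : E n) (y : E m),
        star (ω.map n x) * ω.map m y = ω.map (m - n) (P.annihilate hP x y),
      ∀ n m : ℕ, 1 ≤ n → 1 ≤ m → m < n → ∀ (x : E n) (y : E m),
        star (ω.map n x) * ω.map m y = star (ω.map (n - m) (P.annihilate hP y x)),
      ∀ n m : ℕ, 1 ≤ n → 1 ≤ m → n < m →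
        closedMul (ω.imgStar n) (ω.img m) ⊆ ω.img (m - n),
      ∀ n m : ℕ, 1 ≤ n → 1 ≤ m → m < n →
        closedMul (ω.imgStar n) (ω.img m) ⊆ ω.imgStar (n - m),
      ∀ n m : ℕ, n < m →
        closedMul (closedMul (ω.imgStar n) (ω.img m)) Set.univ ⊆
          closedMul (ω.img (m - n)) Set.univ,
      ∀ n m : ℕ, 1 ≤ n → 1 ≤ m → m < n →
        closedMul Set.univ (closedMul (ω.imgStar n) (ω.img m)) ⊆
          closedMul Set.univ (ω.imgStar (n - m)),
      ∀ m n p q : ℕ,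
        (q ≤ m → closedMul (Set.range (ω.theta m n)) (Set.range (ω.theta p q)) ⊆
          Set.range (ω.theta (m - q + p) n)) ∧
        (m ≤ q → closedMul (Set.range (ω.theta m n)) (Set.range (ω.theta p q)) ⊆
          Set.range (ω.theta p (n + q - m))),
      ω.IsRepresentation] := by
  tfae_have 1 ↔ 2 := by
    constructor
    · intro h n m hn hm hmn x y
      rw [← h m n hm hn hmn y x, star_mul, star_star]
    · intro h n m hn hm hnm x y
      rw [← star_inj, ← h m n hm hn hnm y x, star_mul, star_star]
  tfae_have 1 → 3 := fun h n m hn hm hnm =>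
    ω.closedMul_subset_img fun x y => by rw [h n m hn hm hnm]; exact ω.map_mem_img _
  tfae_have 3 ↔ 4 := by
    constructor
    · intro h n m hn hm hmn c hc
      rw [← star_star c]
      exact ω.star_mem_imgStar _ (h m n hm hn hmn
        (star_mem_closedMul ω.star_mem_img ω.star_mem_imgStar hc))
    · intro h n m hn hm hnm c hc
      rw [← star_star c]
      exact ω.star_mem_img _ (h m n hm hn hnm
        (star_mem_closedMul ω.star_mem_img ω.star_mem_imgStar hc))
  tfae_have 4 → 6 := fun h n m hn hm hmn => closedMul_mono subset_rfl (h n m hn hm hmn)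
  tfae_have 6 → 5 := by
    -- Adjoints swap `n` with `m` and move the factor `B` from the left to the right.
    intro h n m hnm
    rcases Nat.eq_zero_or_pos n with rfl | hn
    · exact closedMul_mono (ω.closedMul_imgStar_zero_subset m) subset_rfl
    intro c hc
    have h1 := h m n (hn.trans hnm) hn hnm (star_mem_closedMul
      (fun b hb => star_mem_closedMul ω.star_mem_img ω.star_mem_imgStar hb)
      (fun b _ => Set.mem_univ (star b)) hc)
    have h2 := star_mem_closedMul (fun b _ => Set.mem_univ (star b)) ω.star_mem_img h1
    rwa [star_star] at h2
  tfae_have 5 → 1 := fun h n m hn hm hnm x y =>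
    ω.star_map_mul_map_eq_annihilate hP hnm.le fun b => h n m hnm (mul_mem_closedMul
      (mul_mem_closedMul (ω.star_map_mem_imgStar x) (ω.map_mem_img y)) (Set.mem_univ b))
  tfae_have 3 → 7 := by
    intro h m n p q
    constructor
    · intro hqm
      refine ω.closedMul_range_theta_subset (LinearMap.range (ω.theta (m - q + p) n).toLinearMap)
        (ω.isClosed_range_theta _ _) fun x y z w => ?_
      -- For `q ≤ m` the middle product is `(ω (m - q) v)⋆`. It is absorbed by the factor to its
      -- right, as `(ω (m - q) v)⋆ (ω p w)⋆ = (ω p w * ω (m - q) v)⋆`; this reverses the order of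
      -- the indices.
      obtain ⟨v, hv⟩ := ω.star_map_mul_map_mem_img_of_le h hqm z y
      have h1 : star (ω.map m y) * ω.map q z = star (ω.map (m - q) v) := by
        rw [hv, star_mul, star_star]
      refine ⟨⟨_, rankOne_mem_compacts x (P.mul (Nat.add_comm p (m - q)) w v)⟩, ?_⟩
      refine (ω.isTheta_theta _ _ _ _).trans ?_
      rw [← ω.map_mul_map', star_mul, ← h1]
      simp only [mul_assoc]
    · intro hmq
      refine ω.closedMul_range_theta_subset (LinearMap.range (ω.theta p (n + q - m)).toLinearMap)
        (ω.isClosed_range_theta _ _) fun x y z w => ?_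
      -- For `m ≤ q` the middle product is `ω (q - m) v`, and the factor `ω n x` to its left absorbs
      -- it.
      obtain ⟨v, hv⟩ := ω.star_map_mul_map_mem_img_of_le h hmq y z
      have hk : n + (q - m) = n + q - m := by omega
      refine ⟨⟨_, rankOne_mem_compacts (P.mul hk x v) w⟩, ?_⟩
      refine (ω.isTheta_theta _ _ _ _).trans ?_
      rw [← ω.map_mul_map', hv]
      simp only [mul_assoc]
  tfae_have 7 → 3 := fun h n m _ _ hnm => ω.closedMul_subset_img
    (ω.star_map_mul_map_mem_img (by have := (h n 0 0 m).2 hnm.le; rwa [Nat.zero_add] at this))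
  tfae_have 3 → 8 := fun h =>
    { subset_of_lt := fun n m hn hnm =>
        (h n m hn (hn.trans hnm) hnm).trans fun _ hc => mem_closedMul_univ hc
      subset_of_gt := fun n m hm hmn => fun c hc => mem_closedMul_univ (by
        rw [← star_star c]
        exact ω.star_mem_imgStar _ (h m n hm (hm.trans hmn) hmn
          (star_mem_closedMul ω.star_mem_img ω.star_mem_imgStar hc))) }
  tfae_have 8 → 5 := by
    intro h n m hnm
    rcases Nat.eq_zero_or_pos n with rfl | hn
    · exact closedMul_mono (ω.closedMul_imgStar_zero_subset m) subset_rfl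
    -- The right-hand side of the inclusion is stable under right multiplication by `B`.
    · exact ω.closedMul_closedMul_univ_subset (h.subset_of_lt n m hn hnm)
  tfae_finish

end WeakRepresentation

end PPS

theorem mainTheorem12 {A : Type*} [NonUnitalCStarAlgebra A] [PartialOrder A] [StarOrderedRing A]
    {E : ℕ → Type*} [∀ n, NormedAddCommGroup (E n)] [∀ n, NormedSpace ℂ (E n)]
    [∀ n, CompleteSpace (E n)] [∀ n, PPS.Correspondence A (E n)]
    (P : PPS.WeakPartialProductSystem A E) (hP : P.FockExists)
    {B : Type*} [NonUnitalCStarAlgebra B] (ω : PPS.WeakRepresentation P B) :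
    ∃ Θ : ∀ m n : ℕ, PPS.compacts A (E m) (E n) →L[ℂ] B,
      ω.IsTheta Θ ∧ (∀ Θ', ω.IsTheta Θ' → Θ' = Θ) ∧
      List.TFAE [
        ∀ n m : ℕ, 1 ≤ n → 1 ≤ m → n < m → ∀ (x : E n) (y : E m),
          star (ω.map n x) * ω.map m y = ω.map (m - n) (P.annihilate hP x y),
        ∀ n m : ℕ, 1 ≤ n → 1 ≤ m → m < n → ∀ (x : E n) (y : E m),
          star (ω.map n x) * ω.map m y = star (ω.map (n - m) (P.annihilate hP y x)),
        ∀ n m : ℕ, 1 ≤ n → 1 ≤ m → n < m →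
          PPS.closedMul (ω.imgStar n) (ω.img m) ⊆ ω.img (m - n),
        ∀ n m : ℕ, 1 ≤ n → 1 ≤ m → m < n →
          PPS.closedMul (ω.imgStar n) (ω.img m) ⊆ ω.imgStar (n - m),
        ∀ n m : ℕ, n < m →
          PPS.closedMul (PPS.closedMul (ω.imgStar n) (ω.img m)) Set.univ ⊆
            PPS.closedMul (ω.img (m - n)) Set.univ,
        ∀ n m : ℕ, 1 ≤ n → 1 ≤ m → m < n →
          PPS.closedMul Set.univ (PPS.closedMul (ω.imgStar n) (ω.img m)) ⊆
            PPS.closedMul Set.univ (ω.imgStar (n - m)),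
        ∀ m n p q : ℕ,
          (q ≤ m → PPS.closedMul (Set.range (Θ m n)) (Set.range (Θ p q)) ⊆
            Set.range (Θ (m - q + p) n)) ∧
          (m ≤ q → PPS.closedMul (Set.range (Θ m n)) (Set.range (Θ p q)) ⊆
            Set.range (Θ p (n + q - m))),
        ω.IsRepresentation] ∧
      (ω.IsRepresentation → ∀ n m : ℕ, 1 ≤ n → 1 ≤ m → m < n →
        PPS.closedMul (PPS.closedMul (ω.imgStar n) (ω.img m)) Set.univ ⊆
          PPS.closedMul (ω.imgStar (n - m)) Set.univ) := by
  refine ⟨ω.theta, ω.isTheta_theta, fun _ h => ω.isTheta_unique h, ?_⟩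
  have tfae := ω.tfae_conditions hP
  refine ⟨tfae, fun h8 n m hn hm hmn => ?_⟩
  -- The positions in `out` count from zero: being a representation yields the inclusion in `ω (n -
  -- m) (E (n - m))⋆`, which is then multiplied by `B` on the right.
  exact PPS.closedMul_mono (((tfae.out 7 3 rfl rfl).mp h8) n m hn hm hmn) subset_rfl
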